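/- Let $0\le d\le N$ be integers, let $\mathcal H$ be a complex Hilbert space with orthonormal basis $e_1,\dots,e_N$, and let $S(d)$ be the symmetric group on $\{1,\dots,d\}$. For $\pi\in S(d)$ let $A_\pi\in\operatorname{End}\mathcal H^{\otimes d}$ be the operator $A_\pi(v_1\otimes\cdots\otimes v_d)=v_{\pi(1)}\otimes\cdots\otimes v_{\pi(d)}$ (these operators are invariant under conjugation by $g^{\otimes d}$, $g\in U(N)$), and equip $\operatorname{End}\mathcal H^{\otimes d}$ with the Hilbert–Schmidt scalar product $\langle A,B\rangle=\operatorname{Tr}A^*B$. Then the Gram matrix of the $A_\pi$ is $$\big[\langle A_\rho,A_\sigma\rangle\big]_{\rho,\sigma\in S(d)}=\big[N^{\#\mathrm{cycles}(\rho^{-1}\sigma)}\big]_{\rho,\sigma\in S(d)},$$ where $\#\mathrm{cycles}(\pi)$ is the number of cycles of $\pi$, fixed points included, and this matrix is invertible. Its inverse $W$, the Weingarten matrix, has the entries $$W_{\rho\sigma}=\sum_{\lambda\vdash d}\frac{\chi^\lambda(\rho^{-1}\sigma)}{\prod_{\Box\in\lambda}(N+c(\Box))}\,\frac{\dim V^\lambda}{d!},\qquad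 \rho,\sigma\in S(d).$$ Here $\lambda$ runs over the partitions of $d$, identified with Young diagrams with $d$ cells; $c(\Box)$ is the content (column index minus row index) of the cell $\Box$; $V^\lambda$ is the irreducible complex representation of $S(d)$ indexed by $\lambda$, realized as the left ideal $\mathbb C S(d)\,c_\lambda$ generated by the Young symmetrizer $c_\lambda=\big(\sum_{p}p\big)\big(\sum_{q}\operatorname{sgn}(q)\,q\big)$, where $p$ runs over the permutations preserving the rows and $q$ over those preserving the columns of the tableau of shape $\lambda$ filled row by row with $1,\dots,d$; and $\chi^\lambda$ is the character of $V^\lambda$. In particular $W_{\rho\sigma}$ depends only on the cycle type of $\rho^{-1}\sigma$: there is a unique function $\mathrm{Wg}^{U(N)}$ on the partitions of $d$ (the unitary Weingarten function) such that $W_{\rho\sigma}=\mathrm{Wg}^{U(N)}(\alpha)$ whenever $\rho^{-1}\sigma$ has cycle type $\alpha$. -/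

import Mathlib

open scoped TensorProduct

noncomputable section

namespace Weingarten

/-! ### Permutations: cycle type and number of cycles (fixed points are cycles of length one) -/

/-- The cycle type of a permutation of `d` symbols, as a partition of `d`. -/
def cycleTypePartition {d : ℕ} (π : Equiv.Perm (Fin d)) : d.Partition where
  parts := π.partition.parts
  parts_pos := π.partition.parts_pos
  parts_sum := π.partition.parts_sum.trans (Fintype.card_fin d)

/-- The number of factors in the disjoint cycle decomposition, fixed points included. -/
def numCycles {d : ℕ} (π : Equiv.Perm (Fin d)) : ℕ :=
  Multiset.card (cycleTypePartition π).parts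

/-! ### The operators permuting tensor factors, their Gram matrix, the Weingarten matrix -/

section Gram

variable {H : Type*} [NormedAddCommGroup H] [InnerProductSpace ℂ H] {N : ℕ}

variable (H) in
/-- The operator `A_π (v₁ ⊗ ⋯ ⊗ v_d) = v_{π(1)} ⊗ ⋯ ⊗ v_{π(d)}` on `H^{⊗d}`. -/
def permOp {d : ℕ} (π : Equiv.Perm (Fin d)) :
    (⨂[ℂ] _ : Fin d, H) →ₗ[ℂ] (⨂[ℂ] _ : Fin d, H) :=
  (PiTensorProduct.reindex ℂ (fun _ : Fin d => H) π.symm).toLinearMap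

theorem permOp_tprod {d : ℕ} (π : Equiv.Perm (Fin d)) (v : Fin d → H) :
    permOp H π (PiTensorProduct.tprod ℂ v) = PiTensorProduct.tprod ℂ (fun k => v (π k)) := by
  simp [permOp]

/-- The basis `e_i = e_{i(1)} ⊗ ⋯ ⊗ e_{i(d)}` of `H^{⊗d}` indexed by functions `i : [d] → [N]`.
It is orthonormal for the scalar product of `H^{⊗d}`. -/
def tensorBasis (e : OrthonormalBasis (Fin N) ℂ H) (d : ℕ) :
    Module.Basis (Fin d → Fin N) ℂ (⨂[ℂ] _ : Fin d, H) :=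
  Basis.piTensorProduct (fun _ : Fin d => e.toBasis)

/-- The Hilbert–Schmidt scalar product `⟨A, B⟩ = Tr A^* B` on `End H^{⊗d}`; the adjoint is the
conjugate transpose in the orthonormal basis `e_i`. -/
def hilbertSchmidt (e : OrthonormalBasis (Fin N) ℂ H) {d : ℕ}
    (A B : (⨂[ℂ] _ : Fin d, H) →ₗ[ℂ] (⨂[ℂ] _ : Fin d, H)) : ℂ :=
  Matrix.trace
    ((LinearMap.toMatrix (tensorBasis e d) (tensorBasis e d) A).conjTranspose *
      LinearMap.toMatrix (tensorBasis e d) (tensorBasis e d) B)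

/-- The Gram matrix `[⟨A_ρ, A_σ⟩]` of the invariants `A_π`, `π ∈ S(d)`. -/
def gramMatrix (e : OrthonormalBasis (Fin N) ℂ H) (d : ℕ) :
    Matrix (Equiv.Perm (Fin d)) (Equiv.Perm (Fin d)) ℂ :=
  Matrix.of fun ρ σ => hilbertSchmidt e (permOp H ρ) (permOp H σ)

/-- The Weingarten matrix of the invariants `A_π`, `π ∈ S(d)`: the inverse Gram matrix. -/
def weingartenMatrix (e : OrthonormalBasis (Fin N) ℂ H) (d : ℕ) :
    Matrix (Equiv.Perm (Fin d)) (Equiv.Perm (Fin d)) ℂ :=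
  (gramMatrix e d)⁻¹

end Gram

/-! ### Young diagrams -/

/-- The Young diagram whose row lengths are the parts of `lam` in weakly decreasing order. -/
def diagram {d : ℕ} (lam : d.Partition) : YoungDiagram :=
  YoungDiagram.ofRowLens (lam.parts.sort (· ≥ ·)) (Multiset.pairwise_sort _ _).sortedGE

theorem card_cellsOfRowLens (w : List ℕ) :
    (YoungDiagram.cellsOfRowLens w).card = w.sum := by
  induction w with
  | nil => simp [YoungDiagram.cellsOfRowLens]
  | cons a w ih =>
    rw [YoungDiagram.cellsOfRowLens, Finset.card_union_of_disjoint]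
    · simp [ih]
    · rw [Finset.disjoint_left]
      rintro ⟨i, j⟩ h1 h2
      simp at h1 h2
      omega

theorem card_diagram {d : ℕ} (lam : d.Partition) : (diagram lam).cells.card = d := by
  have h : (diagram lam).cells.card = (lam.parts.sort (· ≥ ·)).sum := card_cellsOfRowLens _
  rw [h, ← Multiset.sum_coe, Multiset.sort_eq, lam.parts_sum]

/-- The content of a cell `(row, column)`: column index minus row index. -/
def content (c : ℕ × ℕ) : ℤ := (c.2 : ℤ) - (c.1 : ℤ)

/-- The tableau of shape `lam` filled with the symbols of `Fin d` in increasing order, row by row: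
the symbol `k` stands in the `k`-th cell for the lexicographic order on pairs `(row, column)`. -/
def tableau {d : ℕ} (lam : d.Partition) (k : Fin d) : ℕ × ℕ :=
  ofLex (((diagram lam).cells.map toLex.toEmbedding).orderEmbOfFin
    ((Finset.card_map _).trans (card_diagram lam)) k)

/-! ### The irreducible representation of the symmetric group indexed by a Young diagram -/

/-- The permutations that preserve each row of the tableau. -/
def rowStabilizer {d : ℕ} (lam : d.Partition) : Finset (Equiv.Perm (Fin d)) :=
  {π | ∀ k, (tableau lam (π k)).1 = (tableau lam k).1}

/-- The permutations that preserve each column of the tableau. -/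
def colStabilizer {d : ℕ} (lam : d.Partition) : Finset (Equiv.Perm (Fin d)) :=
  {π | ∀ k, (tableau lam (π k)).2 = (tableau lam k).2}

/-- The Young symmetrizer `c_λ = (∑_{p ∈ Row} p) (∑_{q ∈ Col} sgn(q) q)` in `ℂ S(d)`. -/
def youngSymmetrizer {d : ℕ} (lam : d.Partition) : MonoidAlgebra ℂ (Equiv.Perm (Fin d)) :=
  (∑ p ∈ rowStabilizer lam, MonoidAlgebra.single p 1) *
    ∑ q ∈ colStabilizer lam, MonoidAlgebra.single q ((Equiv.Perm.sign q : ℤ) : ℂ)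

/-- The irreducible module `V^λ`: the left ideal of `ℂ S(d)` generated by the Young symmetrizer. -/
abbrev irrep {d : ℕ} (lam : d.Partition) :
    Submodule (MonoidAlgebra ℂ (Equiv.Perm (Fin d))) (MonoidAlgebra ℂ (Equiv.Perm (Fin d))) :=
  Submodule.span _ {youngSymmetrizer lam}

/-- The action `R^λ` of `S(d)` on `V^λ` by left multiplication. -/
def irrepAction {d : ℕ} (lam : d.Partition) :
    Representation ℂ (Equiv.Perm (Fin d)) (irrep lam) :=
  Representation.ofModule' (irrep lam)

/-- The irreducible character `χ^λ`. -/
def irrepChar {d : ℕ} (lam : d.Partition) (π : Equiv.Perm (Fin d)) : ℂ :=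
  (irrepAction lam).character π

/-- The dimension of `V^λ`. -/
def irrepDim {d : ℕ} (lam : d.Partition) : ℕ :=
  Module.finrank ℂ (irrep lam)

end Weingarten

end

/-! In the basis of pure tensors, `⟨A_ρ, A_σ⟩` counts the index functions `i` with `i ∘ ρ = i ∘ σ`.
These correspond to the colourings constant on the cycles of `ρ⁻¹σ`, which gives the power of `N`.
The Gram matrix is thus convolution by the central element `G = ∑ N ^ #cycles(π) π` of the group
algebra, and inverting it amounts to inverting `G`.

The eigenvalues of `G` come from Jucys' factorization of `G` into the factors `N + J_x`, with `J_x`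
the Jucys–Murphy elements. Write `c_λ = a b`, the row sum times the signed column sum. Placed
between the partial sums `a_{x+1}` and `b_{x+1}` of the symbols up to `x`, `J_x` acts as the content
of the cell of `x` (`rowSum_mul_jucysMurphy_mul_colSum`). Peeling off one symbol at a time gives `G
c_λ = ∏ (N + c(□)) c_λ` (`gramElement_mul_youngSymmetrizer`), and `d ≤ N` keeps every factor
nonzero.

The classical combinatorics of tableaux gives `c_λ x c_μ = 0` for `λ ≠ μ` and `c_λ² = n_λ c_λ`. Let
`z_λ` be the sum of the conjugates of `c_λ`. It is central, kills the other `c_μ`, and multiplies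
`c_λ` by `n_λ²`. There are as many partitions as conjugacy classes, so a dimension count yields `∑
n_λ⁻² z_λ = 1` (`sum_conjSum`), whence `G⁻¹ = ∑ (n_λ² ∏ (N + c(□)))⁻¹ z_λ`.

Finally, right multiplication by `c_λ` is `n_λ` times a projection onto `V^λ`. Taking traces
identifies the coefficients of `z_λ` with `n_λ χ^λ`, and at the identity gives `n_λ dim V^λ = d!`.
Neither irreducibility nor Schur's lemma is needed. -/

noncomputable section

namespace Weingarten

variable {d : ℕ}

/-! ### Colourings fixed by a permutation -/

/-- The colourings of `Fin d` by `N` colours that are invariant under `π`. -/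
def fixedColorings (N : ℕ) (π : Equiv.Perm (Fin d)) : Finset (Fin d → Fin N) :=
  {f | ∀ x, f (π x) = f x}

theorem mem_fixedColorings {N : ℕ} {π : Equiv.Perm (Fin d)} {f : Fin d → Fin N} :
    f ∈ fixedColorings N π ↔ ∀ x, f (π x) = f x := by
  simp [fixedColorings]

/-- The label of the cycle of `π` through `x`. -/
def cycleLabel (π : Equiv.Perm (Fin d)) (x : Fin d) : Equiv.Perm (Fin d) ⊕ Fin d :=
  if π x = x then Sum.inr x else Sum.inl (π.cycleOf x)

theorem cycleLabel_apply (π : Equiv.Perm (Fin d)) (x : Fin d) :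
    cycleLabel π (π x) = cycleLabel π x := by
  by_cases h : π x = x
  · rw [h]
  · have h' : ¬ π (π x) = π x := fun h' => h (π.injective h')
    simp only [cycleLabel, h, h', if_false]
    congr 1
    exact Equiv.Perm.cycleOf_self_apply π x

theorem sameCycle_of_cycleLabel_eq {π : Equiv.Perm (Fin d)} {x y : Fin d}
    (h : cycleLabel π x = cycleLabel π y) : π.SameCycle x y := by
  unfold cycleLabel at h
  split_ifs at h with hx hy hy
  · obtain rfl := Sum.inr_injective h
    exact Equiv.Perm.SameCycle.refl _ _
  · have h1 := Sum.inl_injective h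
    have h2 : π.cycleOf x y ≠ y := by rw [h1, Equiv.Perm.cycleOf_apply_self]; exact hy
    by_contra hn
    exact h2 (Equiv.Perm.cycleOf_apply_of_not_sameCycle hn)

/-- `cycleOf` is the identity at every fixed point, so fixed points need labels of their own. The
labels used are then exactly the nontrivial cycles and the fixed points. -/
theorem card_range_cycleLabel (π : Equiv.Perm (Fin d)) :
    (Finset.univ.image (cycleLabel π)).card = numCycles π := by
  have h : Finset.univ.image (cycleLabel π) =
      π.cycleFactorsFinset.disjSum (π.supportᶜ) := by
    ext s
    rcases s with c | x
    · simp only [Finset.mem_image, Finset.mem_univ, true_and, Finset.inl_mem_disjSum]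
      constructor
      · rintro ⟨x, hx⟩
        unfold cycleLabel at hx
        split_ifs at hx with h
        rw [← Sum.inl_injective hx]
        exact Equiv.Perm.cycleOf_mem_cycleFactorsFinset_iff.2 (Equiv.Perm.mem_support.2 h)
      · intro hc
        obtain ⟨x, hx⟩ := (Equiv.Perm.mem_cycleFactorsFinset_iff.1 hc).1.nonempty_support
        refine ⟨x, ?_⟩
        have hx' := Equiv.Perm.mem_cycleFactorsFinset_support_le hc hx
        rw [cycleLabel, if_neg (Equiv.Perm.mem_support.1 hx'),
          Equiv.Perm.cycle_is_cycleOf hx hc]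
    · simp only [Finset.mem_image, Finset.mem_univ, true_and, Finset.inr_mem_disjSum,
        Finset.mem_compl, Equiv.Perm.mem_support, not_not]
      constructor
      · rintro ⟨y, hy⟩
        unfold cycleLabel at hy
        split_ifs at hy with h
        rwa [← Sum.inr_injective hy]
      · intro h
        exact ⟨x, by rw [cycleLabel, if_pos h]⟩
  rw [h, Finset.card_disjSum, Finset.card_compl]
  simp only [numCycles, cycleTypePartition, Equiv.Perm.parts_partition, Multiset.card_add,
    Multiset.card_replicate, Equiv.Perm.cycleType_def, Multiset.card_map]
  rfl

theorem card_fixedColorings (N : ℕ) (π : Equiv.Perm (Fin d)) :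
    (fixedColorings N π).card = N ^ numCycles π := by
  classical
  have key : ∀ f ∈ fixedColorings N π, ∀ x y, cycleLabel π x = cycleLabel π y → f x = f y := by
    intro f hf x y hxy
    obtain ⟨n, rfl⟩ := (sameCycle_of_cycleLabel_eq hxy).exists_nat_pow_eq
    clear hxy
    induction n with
    | zero => simp
    | succ n ih => rw [pow_succ', Equiv.Perm.mul_apply, mem_fixedColorings.1 hf, ← ih]
  rw [← card_range_cycleLabel, ← Fintype.card_coe (Finset.image _ _)]
  conv_rhs => rw [← Fintype.card_fin N, ← Fintype.card_fun]
  rw [← Finset.card_univ]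
  symm
  refine Finset.card_bij
    (fun g _ x => g ⟨cycleLabel π x, Finset.mem_image_of_mem _ (Finset.mem_univ x)⟩) ?_ ?_ ?_
  · intro g _
    rw [mem_fixedColorings]
    intro x
    simp only [cycleLabel_apply]
  · intro g _ g' _ h
    funext ⟨s, hs⟩
    obtain ⟨x, -, rfl⟩ := Finset.mem_image.1 hs
    exact congrFun h x
  · intro f hf
    have hs : ∀ s : Finset.univ.image (cycleLabel π), ∃ x, cycleLabel π x = s := by
      rintro ⟨s, hs⟩
      obtain ⟨x, -, rfl⟩ := Finset.mem_image.1 hs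
      exact ⟨x, rfl⟩
    choose u hu using hs
    exact ⟨fun s => f (u s), Finset.mem_univ _, funext fun x => key f hf _ _ (hu _)⟩

theorem numCycles_conj (ρ π : Equiv.Perm (Fin d)) : numCycles (ρ * π * ρ⁻¹) = numCycles π := by
  have h : (ρ * π * ρ⁻¹).partition = π.partition :=
    Equiv.Perm.partition_eq_of_isConj.1 (isConj_iff.2 ⟨ρ⁻¹, by group⟩)
  simp only [numCycles, cycleTypePartition, h]

theorem fixedColorings_swap_mul (N : ℕ) {π : Equiv.Perm (Fin d)} {x y : Fin d} (hx : π x = x) :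
    fixedColorings N (Equiv.swap x y * π) = {f ∈ fixedColorings N π | f x = f y} := by
  ext f
  simp only [mem_fixedColorings, Finset.mem_filter, Equiv.Perm.mul_apply]
  have hs : f x = f y → ∀ z, f (Equiv.swap x y z) = f z := by
    intro h z
    rcases eq_or_ne z x with rfl | hzx
    · simp [h]
    rcases eq_or_ne z y with rfl | hzy
    · simp [h]
    rw [Equiv.swap_apply_of_ne_of_ne hzx hzy]
  constructor
  · intro h
    have h1 : f x = f y := by simpa [hx] using (h x).symm
    exact ⟨fun z => by rw [← hs h1 (π z)]; exact h z, h1⟩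
  · rintro ⟨h, h1⟩ z
    rw [hs h1, h]

/-- Multiplying by the transposition joins the fixed point `x` to the cycle of `y`, so the colour of
`x`, free before, is forced to be that of `y`. Recolouring `x` freely restores the lost factor `N`.
-/
theorem mul_card_fixedColorings_swap_mul (N : ℕ) {π : Equiv.Perm (Fin d)} {x y : Fin d}
    (hx : π x = x) (hxy : y ≠ x) :
    N * (fixedColorings N (Equiv.swap x y * π)).card = (fixedColorings N π).card := by
  classical
  rw [fixedColorings_swap_mul N hx]
  have hN : N = (Finset.univ : Finset (Fin N)).card := by simp
  conv_lhs => enter [1]; rw [hN]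
  rw [← Finset.card_product]
  have hπ : ∀ z, z ≠ x → π z ≠ x := fun z hz h => hz (π.injective (h.trans hx.symm))
  have hupd : ∀ f ∈ fixedColorings N π, ∀ a, Function.update f x a ∈ fixedColorings N π := by
    intro f hf a
    rw [mem_fixedColorings] at hf ⊢
    intro z
    rcases eq_or_ne z x with rfl | hz
    · rw [hx]
    · rw [Function.update_of_ne hz, Function.update_of_ne (hπ z hz), hf]
  refine Finset.card_bij (fun p _ => Function.update p.2 x p.1) ?_ ?_ ?_
  · rintro ⟨a, f⟩ h
    simp only [Finset.mem_product, Finset.mem_filter] at h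
    exact hupd f h.2.1 a
  · rintro ⟨a, f⟩ h ⟨b, g⟩ h' heq
    simp only [Finset.mem_product, Finset.mem_filter] at h h' heq
    have hz : ∀ z, z ≠ x → f z = g z := fun z hz => by
      simpa [Function.update_of_ne hz] using congrFun heq z
    have ha : a = b := by simpa using congrFun heq x
    refine Prod.ext ha (funext fun z => ?_)
    rcases eq_or_ne z x with rfl | hz'
    · exact h.2.2.trans ((hz _ hxy).trans h'.2.2.symm)
    · exact hz z hz'
  · intro f hf
    refine ⟨(f x, Function.update f x (f y)), ?_, ?_⟩
    · simp only [Finset.mem_product, Finset.mem_filter, Finset.mem_univ, true_and]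
      refine ⟨hupd f hf _, ?_⟩
      rw [Function.update_self, Function.update_of_ne hxy]
    · simp

/-! ### The Gram matrix -/

section Gram

variable {H : Type*} [NormedAddCommGroup H] [InnerProductSpace ℂ H] {N : ℕ}

theorem toMatrix_permOp (e : OrthonormalBasis (Fin N) ℂ H) (π : Equiv.Perm (Fin d))
    (i j : Fin d → Fin N) :
    LinearMap.toMatrix (tensorBasis e d) (tensorBasis e d) (permOp H π) j i =
      if i ∘ π = j then 1 else 0 := by
  have h : permOp H π (tensorBasis e d i) = tensorBasis e d (i ∘ π) := by
    simp only [tensorBasis, Basis.piTensorProduct_apply, permOp_tprod, Function.comp_def]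
  rw [LinearMap.toMatrix_apply, h, Module.Basis.repr_self, Finsupp.single_apply]

theorem gramMatrix_apply (e : OrthonormalBasis (Fin N) ℂ H) (ρ σ : Equiv.Perm (Fin d)) :
    gramMatrix e d ρ σ = (N : ℂ) ^ numCycles (ρ⁻¹ * σ) := by
  classical
  have h1 : gramMatrix e d ρ σ =
      ∑ i : Fin d → Fin N, if i ∘ ρ = i ∘ σ then (1 : ℂ) else 0 := by
    simp only [gramMatrix, hilbertSchmidt, Matrix.of_apply, Matrix.trace, Matrix.diag_apply,
      Matrix.mul_apply, Matrix.conjTranspose_apply, toMatrix_permOp]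
    refine Finset.sum_congr rfl fun i _ => ?_
    rw [Finset.sum_eq_single (i ∘ ρ)]
    · simp [eq_comm]
    · intro j _ hj
      simp [hj.symm]
    · simp
  rw [h1, Finset.sum_boole, ← Nat.cast_pow, ← card_fixedColorings]
  congr 1
  -- If `i ∘ ρ = i ∘ σ`, then `f = i ∘ ρ` satisfies `f ∘ (ρ⁻¹σ) = i ∘ σ = f`.
  refine Finset.card_bij (fun i _ => i ∘ ρ) ?_ ?_ ?_
  · intro i hi
    rw [mem_fixedColorings]
    intro x
    have := congrFun (Finset.mem_filter.1 hi).2 x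
    simpa using this.symm
  · intro i _ j _ h
    exact ρ.surjective.injective_comp_right h
  · intro f hf
    refine ⟨f ∘ ⇑ρ⁻¹, ?_, ?_⟩
    · rw [Finset.mem_filter]
      refine ⟨Finset.mem_univ _, funext fun x => ?_⟩
      simpa using (mem_fixedColorings.1 hf x).symm
    · funext x
      simp

end Gram

/-! ### Sums over Young subgroups -/

/-- The permutations of the symbols `< k` preserving the colouring `t`. -/
def youngPerms (t : Fin d → ℕ) (k : ℕ) : Finset (Equiv.Perm (Fin d)) :=
  {π | (∀ i, t (π i) = t i) ∧ ∀ i : Fin d, k ≤ i → π i = i}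

theorem mem_youngPerms {t : Fin d → ℕ} {k : ℕ} {π : Equiv.Perm (Fin d)} :
    π ∈ youngPerms t k ↔ (∀ i, t (π i) = t i) ∧ ∀ i : Fin d, k ≤ i → π i = i := by
  simp [youngPerms]

theorem mul_mem_youngPerms {t : Fin d → ℕ} {k : ℕ} {π τ : Equiv.Perm (Fin d)}
    (hπ : π ∈ youngPerms t k) (hτ : τ ∈ youngPerms t k) : π * τ ∈ youngPerms t k := by
  rw [mem_youngPerms] at *
  refine ⟨fun i => ?_, fun i hi => ?_⟩
  · rw [Equiv.Perm.mul_apply, hπ.1, hτ.1]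
  · rw [Equiv.Perm.mul_apply, hτ.2 i hi, hπ.2 i hi]

theorem inv_mem_youngPerms {t : Fin d → ℕ} {k : ℕ} {π : Equiv.Perm (Fin d)}
    (hπ : π ∈ youngPerms t k) : π⁻¹ ∈ youngPerms t k := by
  rw [mem_youngPerms] at *
  refine ⟨fun i => ?_, fun i hi => ?_⟩
  · have h := hπ.1 (π⁻¹ i)
    simpa using h.symm
  · rw [Equiv.Perm.inv_eq_iff_eq, hπ.2 i hi]

theorem swap_mem_youngPerms {t : Fin d → ℕ} {k : ℕ} {x y : Fin d} (hx : (x : ℕ) < k)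
    (hy : (y : ℕ) < k) (ht : t x = t y) : Equiv.swap x y ∈ youngPerms t k := by
  rw [mem_youngPerms]
  refine ⟨fun i => ?_, fun i hi => ?_⟩
  · rcases eq_or_ne i x with rfl | hix
    · simp [ht]
    rcases eq_or_ne i y with rfl | hiy
    · simp [ht]
    rw [Equiv.swap_apply_of_ne_of_ne hix hiy]
  · refine Equiv.swap_apply_of_ne_of_ne ?_ ?_
    · rintro rfl; omega
    · rintro rfl; omega

theorem youngPerms_zero (t : Fin d → ℕ) : youngPerms t 0 = {1} := by
  ext π
  rw [mem_youngPerms, Finset.mem_singleton]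
  constructor
  · rintro ⟨-, h⟩
    ext i
    simp [h i (Nat.zero_le _)]
  · rintro rfl
    simp

theorem youngPerms_mono (t : Fin d → ℕ) {k l : ℕ} (h : k ≤ l) :
    youngPerms t k ⊆ youngPerms t l := by
  intro π hπ
  rw [mem_youngPerms] at *
  exact ⟨hπ.1, fun i hi => hπ.2 i (h.trans hi)⟩

/-- Every element of a Young subgroup is the product of a transposition moving the last symbol to
its image and a permutation fixing the last symbol. -/
theorem sum_youngPerms_succ {M : Type*} [AddCommMonoid M] (t : Fin d → ℕ) (x : Fin d)
    (f : Equiv.Perm (Fin d) → M) :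
    ∑ π ∈ youngPerms t (x + 1), f π =
      ∑ y with y ≤ x ∧ t y = t x, ∑ π ∈ youngPerms t x, f (Equiv.swap x y * π) := by
  rw [Finset.sum_sigma']
  symm
  refine Finset.sum_bij (fun p _ => Equiv.swap x p.1 * p.2) ?_ ?_ ?_ ?_
  · rintro ⟨y, π⟩ h
    simp only [Finset.mem_sigma, Finset.mem_filter, Finset.mem_univ, true_and] at h
    refine mul_mem_youngPerms (swap_mem_youngPerms (Nat.lt_succ_self _) ?_ h.1.2.symm)
      (youngPerms_mono t (Nat.le_succ _) h.2)
    exact Nat.lt_succ_of_le h.1.1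
  · rintro ⟨y, π⟩ h ⟨z, τ⟩ h' heq
    simp only [Finset.mem_sigma, Finset.mem_filter, Finset.mem_univ, true_and] at h h' heq
    have hπ := (mem_youngPerms.1 h.2).2 x le_rfl
    have hτ := (mem_youngPerms.1 h'.2).2 x le_rfl
    have hyz : y = z := by
      have := congrArg (fun σ : Equiv.Perm (Fin d) => σ x) heq
      simpa [hπ, hτ] using this
    subst hyz
    rw [mul_left_cancel heq]
  · intro π hπ
    have hπ' := mem_youngPerms.1 hπ
    have hle : π x ≤ x := by
      by_contra hlt
      rw [not_le] at hlt
      have := hπ'.2 (π x) hlt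
      exact hlt.ne (π.injective this).symm
    refine ⟨⟨π x, Equiv.swap x (π x) * π⟩, ?_, ?_⟩
    · simp only [Finset.mem_sigma, Finset.mem_filter, Finset.mem_univ, true_and]
      refine ⟨⟨hle, hπ'.1 x⟩, mem_youngPerms.2 ⟨fun i => ?_, fun i hi => ?_⟩⟩
      · exact (mem_youngPerms.1 (mul_mem_youngPerms (swap_mem_youngPerms (Nat.lt_succ_self _)
          (Nat.lt_succ_of_le hle) (hπ'.1 x).symm) hπ)).1 i
      · rcases eq_or_ne i x with rfl | hix
        · simp
        · have hlt : x < i := lt_of_le_of_ne hi hix.symm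
          rw [Equiv.Perm.mul_apply, hπ'.2 i hlt]
          exact Equiv.swap_apply_of_ne_of_ne hix (hle.trans_lt hlt).ne'
    · simp [← mul_assoc]
  · intros; rfl

theorem sum_youngPerms_inv {M : Type*} [AddCommMonoid M] (t : Fin d → ℕ) (k : ℕ)
    (f : Equiv.Perm (Fin d) → M) :
    ∑ π ∈ youngPerms t k, f π⁻¹ = ∑ π ∈ youngPerms t k, f π :=
  Finset.sum_bij' (fun π _ => π⁻¹) (fun π _ => π⁻¹) (fun _ h => inv_mem_youngPerms h)
    (fun _ h => inv_mem_youngPerms h) (fun _ _ => inv_inv _) (fun _ _ => inv_inv _)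
    (fun _ _ => rfl)

theorem sum_youngPerms_succ_right {M : Type*} [AddCommMonoid M] (t : Fin d → ℕ) (x : Fin d)
    (f : Equiv.Perm (Fin d) → M) :
    ∑ π ∈ youngPerms t (x + 1), f π =
      ∑ y with y ≤ x ∧ t y = t x, ∑ π ∈ youngPerms t x, f (π * Equiv.swap x y) := by
  rw [← sum_youngPerms_inv, sum_youngPerms_succ]
  refine Finset.sum_congr rfl fun y _ => ?_
  rw [← sum_youngPerms_inv]
  refine Finset.sum_congr rfl fun π _ => ?_
  rw [mul_inv_rev, inv_inv, Equiv.swap_inv]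

/-! ### Weighted sums of Young subgroups in the group algebra -/

open MonoidAlgebra

/-- The sign of a permutation as a complex number. -/
def csign (π : Equiv.Perm (Fin d)) : ℂ := ((Equiv.Perm.sign π : ℤ) : ℂ)

theorem csign_mul (π τ : Equiv.Perm (Fin d)) : csign (π * τ) = csign π * csign τ := by
  simp [csign]

theorem csign_swap {x y : Fin d} (h : x ≠ y) : csign (Equiv.swap x y) = -1 := by
  simp [csign, Equiv.Perm.sign_swap h]

theorem csign_mul_self (π : Equiv.Perm (Fin d)) : csign π * csign π = 1 := by
  rcases Int.units_eq_one_or (Equiv.Perm.sign π) with h | h <;> simp [csign, h]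

/-- The sum of a Young subgroup with weights `w`. -/
def youngSum (w : Equiv.Perm (Fin d) → ℂ) (t : Fin d → ℕ) (k : ℕ) :
    MonoidAlgebra ℂ (Equiv.Perm (Fin d)) :=
  ∑ π ∈ youngPerms t k, single π (w π)

theorem youngSum_zero (w : Equiv.Perm (Fin d) → ℂ) (t : Fin d → ℕ) :
    youngSum w t 0 = single 1 (w 1) := by
  rw [youngSum, youngPerms_zero, Finset.sum_singleton]

theorem single_mul_youngSum (w : Equiv.Perm (Fin d) → ℂ)
    (hw : ∀ π τ, w (π * τ) = w π * w τ) {t : Fin d → ℕ} {k : ℕ} {τ : Equiv.Perm (Fin d)}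
    (hτ : τ ∈ youngPerms t k) : single τ (w τ) * youngSum w t k = youngSum w t k := by
  rw [youngSum, Finset.mul_sum]
  refine Finset.sum_bij' (fun π _ => τ * π) (fun π _ => τ⁻¹ * π)
    (fun π h => mul_mem_youngPerms hτ h)
    (fun π h => mul_mem_youngPerms (inv_mem_youngPerms hτ) h) (fun π _ => by simp)
    (fun π _ => by simp) (fun π _ => ?_)
  rw [single_mul_single, hw]

theorem youngSum_mul_single (w : Equiv.Perm (Fin d) → ℂ)
    (hw : ∀ π τ, w (π * τ) = w π * w τ) {t : Fin d → ℕ} {k : ℕ} {τ : Equiv.Perm (Fin d)}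
    (hτ : τ ∈ youngPerms t k) : youngSum w t k * single τ (w τ) = youngSum w t k := by
  rw [youngSum, Finset.sum_mul]
  refine Finset.sum_bij' (fun π _ => π * τ) (fun π _ => π * τ⁻¹)
    (fun π h => mul_mem_youngPerms h hτ)
    (fun π h => mul_mem_youngPerms h (inv_mem_youngPerms hτ)) (fun π _ => by simp)
    (fun π _ => by simp) (fun π _ => ?_)
  rw [single_mul_single, hw]

theorem symmetrizer_mul_single {t : Fin d → ℕ} {k : ℕ} {τ : Equiv.Perm (Fin d)}
    (hτ : τ ∈ youngPerms t k) : youngSum 1 t k * single τ 1 = youngSum 1 t k :=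
  youngSum_mul_single 1 (by simp) hτ

theorem single_mul_antisymmetrizer {t : Fin d → ℕ} {k : ℕ} {τ : Equiv.Perm (Fin d)}
    (hτ : τ ∈ youngPerms t k) :
    single τ 1 * youngSum csign t k = csign τ • youngSum csign t k := by
  conv_rhs => rw [← single_mul_youngSum csign csign_mul hτ]
  rw [← smul_mul_assoc, smul_single, smul_eq_mul, csign_mul_self]

theorem youngSum_succ (w : Equiv.Perm (Fin d) → ℂ) (hw : ∀ π τ, w (π * τ) = w π * w τ)
    (t : Fin d → ℕ) (x : Fin d) :
    youngSum w t (x + 1) = (∑ y with y ≤ x ∧ t y = t x,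
      single (Equiv.swap x y) (w (Equiv.swap x y))) * youngSum w t x := by
  rw [youngSum, sum_youngPerms_succ, Finset.sum_mul]
  refine Finset.sum_congr rfl fun y _ => ?_
  rw [youngSum, Finset.mul_sum]
  refine Finset.sum_congr rfl fun π _ => ?_
  rw [single_mul_single, hw]

theorem youngSum_succ_right (w : Equiv.Perm (Fin d) → ℂ) (hw : ∀ π τ, w (π * τ) = w π * w τ)
    (t : Fin d → ℕ) (x : Fin d) :
    youngSum w t (x + 1) = youngSum w t x * ∑ y with y ≤ x ∧ t y = t x,
      single (Equiv.swap x y) (w (Equiv.swap x y)) := by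
  rw [youngSum, sum_youngPerms_succ_right, Finset.mul_sum]
  refine Finset.sum_congr rfl fun y _ => ?_
  rw [youngSum, Finset.sum_mul]
  refine Finset.sum_congr rfl fun π _ => ?_
  rw [single_mul_single, hw]

/-! ### Jucys–Murphy elements -/

/-- The Jucys–Murphy element of the symbol `x`. -/
def jucysMurphy (x : Fin d) : MonoidAlgebra ℂ (Equiv.Perm (Fin d)) :=
  ∑ y with y < x, single (Equiv.swap x y) 1

/-- Such a `π` fixes `x` and permutes the smaller symbols, so conjugation by it permutes the
transpositions in `J_x`. -/
theorem single_commute_jucysMurphy {t : Fin d → ℕ} {x : Fin d} {π : Equiv.Perm (Fin d)}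
    (hπ : π ∈ youngPerms t x) (a : ℂ) : Commute (single π a) (jucysMurphy x) := by
  have hπ' := (mem_youngPerms.1 hπ).2
  have hlt : ∀ τ ∈ youngPerms t x, ∀ y, y < x → τ y < x := by
    intro τ hτ y hy
    by_contra h
    rw [not_lt] at h
    have := τ.injective ((mem_youngPerms.1 hτ).2 _ h)
    rw [this] at h
    exact absurd hy (not_lt.2 h)
  rw [Commute, SemiconjBy, jucysMurphy, Finset.mul_sum, Finset.sum_mul]
  refine Finset.sum_bij' (fun y _ => π y) (fun y _ => π⁻¹ y) ?_ ?_ (by simp) (by simp) ?_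
  · intro y hy
    simpa using hlt π hπ y (by simpa using hy)
  · intro y hy
    simpa using hlt π⁻¹ (inv_mem_youngPerms hπ) y (by simpa using hy)
  · intro y _
    rw [single_mul_single, single_mul_single, mul_one, one_mul, Equiv.mul_swap_eq_swap_mul,
      hπ' x le_rfl]

theorem youngSum_commute_jucysMurphy (w : Equiv.Perm (Fin d) → ℂ) (t : Fin d → ℕ) (x : Fin d) :
    Commute (youngSum w t x) (jucysMurphy x) :=
  Commute.sum_left _ _ _ fun _ hπ => single_commute_jucysMurphy hπ _

/-- The number of invariant colourings as a complex weight. -/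
def colorWeight (N : ℕ) (π : Equiv.Perm (Fin d)) : ℂ := (fixedColorings N π).card

theorem colorWeight_eq (N : ℕ) (π : Equiv.Perm (Fin d)) :
    colorWeight N π = (N : ℂ) ^ numCycles π := by
  rw [colorWeight, card_fixedColorings, Nat.cast_pow]

/-- One step of Jucys' factorization. The constant colouring `0` imposes no constraint, so the sums
run over all permutations of the first symbols. The term `y = x` gives `N`, and each `y < x` merges
two cycles, which costs a factor `N`. Keeping `N` on the left avoids division. -/
theorem smul_youngSum_colorWeight_succ (N : ℕ) (x : Fin d) :
    (N : ℂ) • youngSum (colorWeight N) 0 (x + 1) =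
      ((N : ℂ) • 1 + jucysMurphy x) * youngSum (colorWeight N) 0 x := by
  have hsplit : Finset.univ.filter (fun y => y ≤ x ∧ (0 : Fin d → ℕ) y = (0 : Fin d → ℕ) x) =
      insert x (Finset.univ.filter fun y => y < x) := by
    ext y
    simp [le_iff_eq_or_lt]
  rw [youngSum, sum_youngPerms_succ, hsplit, Finset.sum_insert (by simp), smul_add, add_mul]
  congr 1
  · simp [youngSum, Equiv.swap_self, ← Equiv.Perm.one_def]
  · rw [jucysMurphy, Finset.sum_mul, Finset.smul_sum]
    refine Finset.sum_congr rfl fun y hy => ?_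
    rw [youngSum, Finset.mul_sum, Finset.smul_sum]
    refine Finset.sum_congr rfl fun π hπ => ?_
    have hyx : y ≠ x := by
      simp only [Finset.mem_filter, Finset.mem_univ, true_and] at hy
      exact hy.ne
    rw [single_mul_single, smul_single, one_mul, smul_eq_mul, colorWeight, colorWeight,
      ← Nat.cast_mul, mul_card_fixedColorings_swap_mul N ((mem_youngPerms.1 hπ).2 x le_rfl) hyx]

/-! ### The row reading tableau -/

theorem tableau_strictMono (lam : d.Partition) : StrictMono fun k => toLex (tableau lam k) :=
  fun _ _ h => (Finset.orderEmbOfFin _ ((Finset.card_map _).trans (card_diagram lam))).strictMono h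

theorem tableau_injective (lam : d.Partition) : Function.Injective (tableau lam) :=
  fun _ _ h => (tableau_strictMono lam).injective (congrArg toLex h)

theorem tableau_mem (lam : d.Partition) (k : Fin d) : tableau lam k ∈ (diagram lam).cells := by
  have h := Finset.orderEmbOfFin_mem ((diagram lam).cells.map toLex.toEmbedding)
    ((Finset.card_map _).trans (card_diagram lam)) k
  obtain ⟨c, hc, h⟩ := Finset.mem_map.1 h
  have h' : tableau lam k = c := by
    rw [tableau, ← h]
    rfl
  rwa [h']

theorem exists_tableau_eq (lam : d.Partition) {c : ℕ × ℕ} (hc : c ∈ (diagram lam).cells) :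
    ∃ k, tableau lam k = c := by
  have h := Finset.range_orderEmbOfFin ((diagram lam).cells.map toLex.toEmbedding)
    ((Finset.card_map _).trans (card_diagram lam))
  have hc' : toLex c ∈ Set.range (((diagram lam).cells.map toLex.toEmbedding).orderEmbOfFin
    ((Finset.card_map _).trans (card_diagram lam))) := by
    rw [h]
    simpa using hc
  obtain ⟨k, hk⟩ := hc'
  exact ⟨k, by rw [tableau, hk]; rfl⟩

theorem exists_tableau_eq_of_le (lam : d.Partition) (x : Fin d) {i j : ℕ}
    (hi : i ≤ (tableau lam x).1) (hj : j ≤ (tableau lam x).2) : ∃ k, tableau lam k = (i, j) :=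
  exists_tableau_eq lam ((diagram lam).up_left_mem hi hj (tableau_mem lam x))

theorem tableau_lt_iff (lam : d.Partition) (x y : Fin d) :
    y < x ↔ (tableau lam y).1 < (tableau lam x).1 ∨
      (tableau lam y).1 = (tableau lam x).1 ∧ (tableau lam y).2 < (tableau lam x).2 := by
  rw [← (tableau_strictMono lam).lt_iff_lt, Prod.Lex.toLex_lt_toLex]

theorem card_row_lt (lam : d.Partition) (x : Fin d) :
    (Finset.univ.filter fun y => y < x ∧ (tableau lam y).1 = (tableau lam x).1).card =
      (tableau lam x).2 := by
  conv_rhs => rw [← Finset.card_range (tableau lam x).2]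
  refine Finset.card_bij (fun y _ => (tableau lam y).2) ?_ ?_ ?_
  · intro y hy
    simp only [Finset.mem_filter, Finset.mem_univ, true_and, tableau_lt_iff lam] at hy
    simp only [Finset.mem_range]
    omega
  · intro y hy z hz h
    simp only [Finset.mem_filter, Finset.mem_univ, true_and] at hy hz
    exact tableau_injective lam (Prod.ext (hy.2.trans hz.2.symm) h)
  · intro j hj
    rw [Finset.mem_range] at hj
    obtain ⟨y, hy⟩ := exists_tableau_eq_of_le lam x le_rfl hj.le
    refine ⟨y, ?_, by rw [hy]⟩
    simp [tableau_lt_iff lam, hy, hj]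

theorem card_col_lt (lam : d.Partition) (x : Fin d) :
    (Finset.univ.filter fun y => y < x ∧ (tableau lam y).2 = (tableau lam x).2).card =
      (tableau lam x).1 := by
  conv_rhs => rw [← Finset.card_range (tableau lam x).1]
  refine Finset.card_bij (fun y _ => (tableau lam y).1) ?_ ?_ ?_
  · intro y hy
    simp only [Finset.mem_filter, Finset.mem_univ, true_and, tableau_lt_iff lam] at hy
    simp only [Finset.mem_range]
    omega
  · intro y hy z hz h
    simp only [Finset.mem_filter, Finset.mem_univ, true_and] at hy hz
    exact tableau_injective lam (Prod.ext h (hy.2.trans hz.2.symm))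
  · intro i hi
    rw [Finset.mem_range] at hi
    obtain ⟨y, hy⟩ := exists_tableau_eq_of_le lam x hi.le le_rfl
    refine ⟨y, ?_, by rw [hy]⟩
    simp [tableau_lt_iff lam, hy, hi]

/-! ### The product of all factors `N + content` -/

/-- The partial row symmetrizer of the tableau. -/
abbrev rowSum (lam : d.Partition) (k : ℕ) : MonoidAlgebra ℂ (Equiv.Perm (Fin d)) :=
  youngSum 1 (fun i => (tableau lam i).1) k

/-- The partial column antisymmetrizer of the tableau. -/
abbrev colSum (lam : d.Partition) (k : ℕ) : MonoidAlgebra ℂ (Equiv.Perm (Fin d)) :=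
  youngSum csign (fun i => (tableau lam i).2) k

/-- The transposition of `σ x` and `σ y` is absorbed by the symmetrizer; carried across `σ` it
becomes that of `x` and `y`, which the antisymmetrizer turns into `-1`. The product equals its own
negative. -/
theorem rowSum_mul_single_mul_colSum_eq_zero (s t : Fin d → ℕ) (k : ℕ)
    {σ : Equiv.Perm (Fin d)} {x y : Fin d} (hxy : x ≠ y) (hx : (x : ℕ) < k) (hy : (y : ℕ) < k)
    (hσx : (σ x : ℕ) < k) (hσy : (σ y : ℕ) < k) (hs : s (σ x) = s (σ y)) (ht : t x = t y) :
    youngSum 1 s k * single σ 1 * youngSum csign t k = 0 := by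
  have h1 : Equiv.swap (σ x) (σ y) ∈ youngPerms s k := swap_mem_youngPerms hσx hσy hs
  have h2 : Equiv.swap x y ∈ youngPerms t k := swap_mem_youngPerms hx hy ht
  have h : youngSum 1 s k * single σ 1 * youngSum csign t k =
      -(youngSum 1 s k * single σ 1 * youngSum csign t k) := by
    conv_lhs => rw [← symmetrizer_mul_single h1, mul_assoc (youngSum 1 s k), single_mul_single,
      ← Equiv.mul_swap_eq_swap_mul, ← single_mul_single, ← mul_assoc, mul_assoc,
      single_mul_antisymmetrizer h2, csign_swap hxy, neg_smul, one_smul, mul_neg]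
  have h3 : (2 : ℂ) • (youngSum 1 s k * single σ 1 * youngSum csign t k) = 0 := by
    rw [two_smul]
    nth_rewrite 1 [h]
    exact neg_add_cancel _
  exact (smul_eq_zero.1 h3).resolve_left two_ne_zero

/-- A transposition of `x` with an earlier symbol of its row contributes `1`, with one of its column
`-1`, and any other contributes `0`. In row reading order all cells to the left of `x` and all cells
above it come earlier, so the total is column minus row. -/
theorem rowSum_mul_jucysMurphy_mul_colSum (lam : d.Partition) (x : Fin d) :
    rowSum lam (x + 1) * jucysMurphy x * colSum lam (x + 1) =
      (content (tableau lam x) : ℂ) • (rowSum lam (x + 1) * colSum lam (x + 1)) := by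
  have hterm : ∀ y ∈ Finset.univ.filter (fun y => y < x),
      rowSum lam (x + 1) * single (Equiv.swap x y) 1 * colSum lam (x + 1) =
      (((if (tableau lam y).1 = (tableau lam x).1 then 1 else 0 : ℂ) -
        (if (tableau lam y).2 = (tableau lam x).2 then 1 else 0)) : ℂ) •
        (rowSum lam (x + 1) * colSum lam (x + 1)) := by
    intro y hy
    simp only [Finset.mem_filter, Finset.mem_univ, true_and] at hy
    have hx1 : (x : ℕ) < x + 1 := Nat.lt_succ_self _
    have hy1 : (y : ℕ) < x + 1 := Nat.lt_succ_of_lt hy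
    by_cases hr : (tableau lam y).1 = (tableau lam x).1
    · have hc : ¬ (tableau lam y).2 = (tableau lam x).2 := fun hc =>
        hy.ne (tableau_injective lam (Prod.ext hr hc))
      rw [if_pos hr, if_neg hc, sub_zero, one_smul,
        symmetrizer_mul_single (swap_mem_youngPerms hx1 hy1 hr.symm)]
    · by_cases hc : (tableau lam y).2 = (tableau lam x).2
      · rw [if_neg hr, if_pos hc, zero_sub, mul_assoc,
          single_mul_antisymmetrizer (swap_mem_youngPerms hx1 hy1 hc.symm), csign_swap hy.ne',
          mul_smul_comm]
      · rw [if_neg hr, if_neg hc, sub_zero, zero_smul]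
        have hlt : (tableau lam y).1 < (tableau lam x).1 := by
          have := (tableau_lt_iff lam x y).1 hy
          omega
        -- The symbol `z` in the row of `y` and the column of `x`: the transposition sends `x` and
        -- `z`, of one column, to `y` and `z`, of one row.
        obtain ⟨z, hz⟩ := exists_tableau_eq_of_le lam x hlt.le le_rfl
        have hzx : z < x := by simp [tableau_lt_iff lam, hz, hlt]
        have hzy : z ≠ y := by
          rintro rfl
          exact hc (by rw [hz])
        have hsz : Equiv.swap x y z = z := Equiv.swap_apply_of_ne_of_ne hzx.ne hzy
        have hz1 : (z : ℕ) < x + 1 := Nat.lt_succ_of_lt hzx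
        refine rowSum_mul_single_mul_colSum_eq_zero _ _ _ hzx.ne' hx1 hz1 ?_ ?_ ?_ ?_
        · simpa using hy1
        · rwa [hsz]
        · simp [hsz, hz]
        · simp [hz]
  rw [jucysMurphy, Finset.mul_sum, Finset.sum_mul, Finset.sum_congr rfl hterm, ← Finset.sum_smul]
  congr 1
  rw [Finset.sum_sub_distrib, Finset.sum_boole, Finset.sum_boole, Finset.filter_filter,
    Finset.filter_filter, card_row_lt, card_col_lt, content]
  push_cast
  ring

/-- The new factors of the row and column sums are split off on the outer sides. `J_x` commutes with
the old row sum, so it can be moved out to apply the induction hypothesis, then back in to act as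
the content. -/
theorem pow_smul_rowSum_mul_mul_colSum (N : ℕ) (lam : d.Partition) (k : ℕ) (hk : k ≤ d) :
    (N : ℂ) ^ k • (rowSum lam k * youngSum (colorWeight N) 0 k * colSum lam k) =
      ((N : ℂ) ^ d * ∏ i ∈ Finset.univ.filter (fun i : Fin d => (i : ℕ) < k), ((N : ℂ) + (content (tableau lam i) : ℂ))) •
        (rowSum lam k * colSum lam k) := by
  induction k with
  | zero =>
    -- The weight counts colourings of all `d` symbols, including those not yet permuted; hence the
    -- factor `N ^ d`.
    have h1 : colorWeight N (1 : Equiv.Perm (Fin d)) = (N : ℂ) ^ d := by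
      have : fixedColorings N (1 : Equiv.Perm (Fin d)) = Finset.univ := by
        ext f; simp [mem_fixedColorings]
      rw [colorWeight, this]
      simp
    simp only [rowSum, colSum, youngSum_zero, single_mul_single, smul_single, h1]
    simp [csign]
  | succ k ih =>
    obtain ⟨x, rfl⟩ : ∃ x : Fin d, (x : ℕ) = k := ⟨⟨k, hk⟩, rfl⟩
    specialize ih x.2.le
    set R := ∑ y with y ≤ x ∧ (tableau lam y).1 = (tableau lam x).1,
      single (Equiv.swap x y) ((1 : Equiv.Perm (Fin d) → ℂ) (Equiv.swap x y)) with hR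
    set C := ∑ y with y ≤ x ∧ (tableau lam y).2 = (tableau lam x).2,
      single (Equiv.swap x y) (csign (Equiv.swap x y)) with hC
    have ha : rowSum lam (x + 1) = R * rowSum lam x := youngSum_succ 1 (by simp) _ x
    have hb : colSum lam (x + 1) = colSum lam x * C := youngSum_succ_right csign csign_mul _ x
    have hg := smul_youngSum_colorWeight_succ N x
    set J := (N : ℂ) • 1 + jucysMurphy x with hJ
    have hcomm : rowSum lam x * J = J * rowSum lam x := by
      rw [hJ, mul_add, add_mul, (youngSum_commute_jucysMurphy _ _ x).eq]
      simp
    have hprod : ∏ i ∈ Finset.univ.filter (fun i : Fin d => (i : ℕ) < x + 1), ((N : ℂ) + (content (tableau lam i) : ℂ)) =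
        (∏ i ∈ Finset.univ.filter (fun i : Fin d => (i : ℕ) < x), ((N : ℂ) + (content (tableau lam i) : ℂ))) *
          ((N : ℂ) + (content (tableau lam x) : ℂ)) := by
      have : (Finset.univ.filter fun i : Fin d => (i : ℕ) < x + 1) =
          insert x (Finset.univ.filter fun i : Fin d => (i : ℕ) < x) := by
        ext i
        simp only [Finset.mem_filter, Finset.mem_univ, true_and, Finset.mem_insert, Fin.ext_iff]
        omega
      rw [this, Finset.prod_insert (by simp), mul_comm]
    have hlast : rowSum lam (x + 1) * J * colSum lam (x + 1) =
        ((N : ℂ) + (content (tableau lam x) : ℂ)) •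
          (rowSum lam (x + 1) * colSum lam (x + 1)) := by
      rw [hJ, mul_add, add_mul, rowSum_mul_jucysMurphy_mul_colSum, add_smul]
      simp
    calc (N : ℂ) ^ ((x : ℕ) + 1) • (rowSum lam (x + 1) * youngSum (colorWeight N) 0 (x + 1) *
          colSum lam (x + 1))
        = (N : ℂ) ^ (x : ℕ) • (R * (rowSum lam x * J) * youngSum (colorWeight N) 0 x *
            (colSum lam x * C)) := by
          rw [pow_succ, mul_smul, ← smul_mul_assoc (N : ℂ), ← mul_smul_comm (N : ℂ), hg, ha, hb]
          simp only [mul_assoc]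
      _ = R * J * ((N : ℂ) ^ (x : ℕ) • (rowSum lam x * youngSum (colorWeight N) 0 x *
            colSum lam x)) * C := by
          rw [hcomm, mul_smul_comm, smul_mul_assoc]
          simp only [mul_assoc]
      _ = ((N : ℂ) ^ d * ∏ i ∈ Finset.univ.filter (fun i : Fin d => (i : ℕ) < x),
            ((N : ℂ) + (content (tableau lam i) : ℂ))) •
            (R * (J * rowSum lam x) * (colSum lam x * C)) := by
          rw [ih, mul_smul_comm, smul_mul_assoc]
          simp only [mul_assoc]
      _ = _ := by
          rw [← hcomm, ← mul_assoc R, ← ha, ← hb, hlast, smul_smul, hprod, mul_assoc]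

/-- The central element `∑ π, N ^ #cycles(π) π`. -/
def gramElement (d N : ℕ) : MonoidAlgebra ℂ (Equiv.Perm (Fin d)) :=
  ∑ π, single π ((N : ℂ) ^ numCycles π)

theorem youngPerms_top (t : Fin d → ℕ) :
    youngPerms t d = Finset.univ.filter fun π => ∀ i, t (π i) = t i := by
  ext π
  rw [mem_youngPerms]
  simp only [Finset.mem_filter, Finset.mem_univ, true_and, and_iff_left_iff_imp]
  exact fun _ i hi => absurd i.2 (not_lt.2 hi)

theorem gramElement_eq (d N : ℕ) : gramElement d N = youngSum (colorWeight N) 0 d := by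
  simp [gramElement, youngSum, youngPerms_top, colorWeight_eq]

theorem youngSymmetrizer_eq (lam : d.Partition) :
    youngSymmetrizer lam = rowSum lam d * colSum lam d := by
  simp only [youngSymmetrizer, rowSum, colSum, youngSum, youngPerms_top]
  rfl

theorem prod_content_eq (N : ℕ) (lam : d.Partition) :
    ∏ i ∈ Finset.univ.filter (fun i : Fin d => (i : ℕ) < d), ((N : ℂ) + (content (tableau lam i) : ℂ)) =
      ∏ c ∈ (diagram lam).cells, ((N : ℂ) + (content c : ℂ)) := by
  refine Finset.prod_bij (fun i _ => tableau lam i) (fun i _ => tableau_mem lam i)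
    (fun i _ j _ h => tableau_injective lam h) (fun c hc => ?_) (fun _ _ => rfl)
  obtain ⟨k, hk⟩ := exists_tableau_eq lam hc
  exact ⟨k, by simp, hk⟩

theorem sum_single_commute {w : Equiv.Perm (Fin d) → ℂ} (hw : ∀ π τ, w (τ⁻¹ * π * τ) = w π)
    (x : MonoidAlgebra ℂ (Equiv.Perm (Fin d))) : Commute (∑ π, single π (w π)) x := by
  induction x using MonoidAlgebra.induction_linear with
  | zero => exact Commute.zero_right _
  | add x y hx hy => exact hx.add_right hy
  | single τ a =>
    rw [Commute, SemiconjBy, Finset.sum_mul, Finset.mul_sum]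
    refine Finset.sum_bij' (fun π _ => τ⁻¹ * π * τ) (fun π _ => τ * π * τ⁻¹) (by simp) (by simp)
      (fun π _ => by group) (fun π _ => by group) (fun π _ => ?_)
    rw [single_mul_single, single_mul_single, hw, mul_comm a]
    congr 1
    group

theorem gramElement_commute (d N : ℕ) (x : MonoidAlgebra ℂ (Equiv.Perm (Fin d))) :
    Commute (gramElement d N) x := by
  refine sum_single_commute (fun π τ => ?_) x
  have h := numCycles_conj τ⁻¹ π
  rw [inv_inv] at h
  rw [h]

/-- The case `k = d`, where `N ^ d ≠ 0` cancels and the central element moves out from between the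
row and column sums. -/
theorem gramElement_mul_youngSymmetrizer {N : ℕ} (hd : d ≤ N) (lam : d.Partition) :
    gramElement d N * youngSymmetrizer lam =
      (∏ c ∈ (diagram lam).cells, ((N : ℂ) + (content c : ℂ))) • youngSymmetrizer lam := by
  have h := pow_smul_rowSum_mul_mul_colSum N lam d le_rfl
  have hN : (N : ℂ) ^ d ≠ 0 := by
    rcases Nat.eq_zero_or_pos d with rfl | hpos
    · simp
    · exact pow_ne_zero _ (Nat.cast_ne_zero.2 (by omega))
  rw [mul_smul, prod_content_eq, ← gramElement_eq] at h
  rw [youngSymmetrizer_eq, ← smul_right_injective _ hN h, ← mul_assoc,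
    (gramElement_commute d N _).eq]

/-- The cells above `x` in its column hold smaller symbols, so its row index is at most `x < d ≤ N`
and `N + c(□)` is positive. -/
theorem prod_content_ne_zero {N : ℕ} (hd : d ≤ N) (lam : d.Partition) :
    ∏ c ∈ (diagram lam).cells, ((N : ℂ) + (content c : ℂ)) ≠ 0 := by
  refine Finset.prod_ne_zero_iff.2 fun c hc => ?_
  obtain ⟨x, rfl⟩ := exists_tableau_eq lam hc
  have h1 : (tableau lam x).1 ≤ x := by
    rw [← card_col_lt lam x]
    refine (Finset.card_le_card (t := Finset.Iio x) fun y hy => ?_).trans (Fin.card_Iio x).le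
    simp only [Finset.mem_filter, Finset.mem_univ, true_and] at hy
    simpa using hy.1
  have h2 : (N : ℤ) + content (tableau lam x) ≠ 0 := by
    have := x.2
    simp only [content]
    omega
  exact_mod_cast h2

/-! ### Dominance -/

/-- The number of cells in the first `k` rows. -/
def rowCount (lam : d.Partition) (k : ℕ) : ℕ :=
  (Finset.univ.filter fun x => (tableau lam x).1 < k).card

/-- The number of cells of column `j` in the first `k` rows. -/
def colRowCount (lam : d.Partition) (k j : ℕ) : ℕ :=
  (Finset.univ.filter fun x => (tableau lam x).1 < k ∧ (tableau lam x).2 = j).card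

/-- No two symbols in a common column of `mu` are sent by `σ` to a common row of `lam`. -/
def Transversal (lam mu : d.Partition) (σ : Equiv.Perm (Fin d)) : Prop :=
  ∀ x y, (tableau lam (σ x)).1 = (tableau lam (σ y)).1 →
    (tableau mu x).2 = (tableau mu y).2 → x = y

/-- The symbols of a column land in distinct rows, so at most `k` of them reach the first `k` rows.
If the column is longer than `k`, it has `k` cells there; otherwise all of its cells lie there. -/
theorem card_le_colRowCount {lam mu : d.Partition} {σ : Equiv.Perm (Fin d)}
    (h : Transversal lam mu σ) (k j : ℕ) :
    (Finset.univ.filter fun x => (tableau lam (σ x)).1 < k ∧ (tableau mu x).2 = j).card ≤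
      colRowCount mu k j := by
  by_cases hall : ∀ x, (tableau mu x).2 = j → (tableau mu x).1 < k
  · refine Finset.card_le_card fun x hx => ?_
    simp only [Finset.mem_filter, Finset.mem_univ, true_and] at hx ⊢
    exact ⟨hall x hx.2, hx.2⟩
  · push Not at hall
    obtain ⟨x, hxj, hxk⟩ := hall
    calc _ ≤ (Finset.range k).card := by
          refine Finset.card_le_card_of_injOn (fun x => (tableau lam (σ x)).1) ?_ ?_
          · intro y hy
            simp only [Finset.coe_filter, Finset.mem_univ, true_and, Set.mem_ofPred_eq] at hy
            simpa using hy.1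
          · intro y hy z hz hyz
            simp only [Finset.coe_filter, Finset.mem_univ, true_and, Set.mem_ofPred_eq] at hy hz
            exact h y z hyz (hy.2.trans hz.2.symm)
      _ ≤ ((Finset.univ.filter fun x => (tableau mu x).1 < k ∧ (tableau mu x).2 = j).image
            fun x => (tableau mu x).1).card := by
          refine Finset.card_le_card fun i hi => ?_
          rw [Finset.mem_range] at hi
          obtain ⟨z, hz⟩ := exists_tableau_eq_of_le mu x (hi.le.trans hxk) hxj.ge
          rw [Finset.mem_image]
          exact ⟨z, by simp [hz, hi], by rw [hz]⟩
      _ ≤ _ := Finset.card_image_le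

theorem rowCount_eq_sum (lam mu : d.Partition) (σ : Equiv.Perm (Fin d)) (k : ℕ) :
    rowCount lam k = ∑ j ∈ Finset.univ.image fun x => (tableau mu x).2,
      (Finset.univ.filter fun x => (tableau lam (σ x)).1 < k ∧ (tableau mu x).2 = j).card := by
  have h1 : rowCount lam k = (Finset.univ.filter fun x => (tableau lam (σ x)).1 < k).card := by
    refine Finset.card_bij' (fun x _ => σ⁻¹ x) (fun x _ => σ x) ?_ ?_ (by simp) (by simp)
    · intro x hx
      simpa using hx
    · intro x hx
      simpa using hx
  rw [h1, Finset.card_eq_sum_card_fiberwise (f := fun x => (tableau mu x).2)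
    (t := Finset.univ.image fun x => (tableau mu x).2) (fun x _ => by simp)]
  simp only [Finset.filter_filter]

theorem rowCount_le_of_transversal {lam mu : d.Partition} {σ : Equiv.Perm (Fin d)}
    (h : Transversal lam mu σ) (k : ℕ) : rowCount lam k ≤ rowCount mu k := by
  rw [rowCount_eq_sum lam mu σ, rowCount_eq_sum mu mu 1]
  exact Finset.sum_le_sum fun j _ => card_le_colRowCount h k j

/-- For `mu = lam` both sides have the same sum over the columns, so every columnwise inequality is
an equality. -/
theorem card_eq_colRowCount {lam : d.Partition} {σ : Equiv.Perm (Fin d)}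
    (h : Transversal lam lam σ) (k j : ℕ) :
    (Finset.univ.filter fun x => (tableau lam (σ x)).1 < k ∧ (tableau lam x).2 = j).card =
      colRowCount lam k j := by
  by_cases hj : j ∈ Finset.univ.image fun x => (tableau lam x).2
  · refine (Finset.sum_eq_sum_iff_of_le fun j _ => card_le_colRowCount h k j).1 ?_ j hj
    rw [← rowCount_eq_sum lam lam σ]
    exact rowCount_eq_sum lam lam 1 k
  · have hj' : ∀ x, (tableau lam x).2 ≠ j := by simpa using hj
    simp [colRowCount, hj']

theorem exists_tableau_eq_of_transversal {lam : d.Partition} {σ : Equiv.Perm (Fin d)}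
    (h : Transversal lam lam σ) (x : Fin d) :
    ∃ z, tableau lam z = ((tableau lam (σ x)).1, (tableau lam x).2) := by
  by_contra! hno
  set k := (tableau lam (σ x)).1 with hk
  set j := (tableau lam x).2 with hj
  -- If the cell `(k, j)` is missing, the count for column `j` does not change from `k` to `k + 1`;
  -- yet `x` itself is sent to row `k`.
  have h1 : colRowCount lam (k + 1) j = colRowCount lam k j := by
    unfold colRowCount
    congr 1
    ext z
    simp only [Finset.mem_filter, Finset.mem_univ, true_and]
    refine ⟨fun hz => ⟨?_, hz.2⟩, fun hz => ⟨by omega, hz.2⟩⟩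
    have h2 : (tableau lam z).1 ≠ k := fun h3 => hno z (Prod.ext h3 hz.2)
    omega
  rw [← card_eq_colRowCount h, ← card_eq_colRowCount h] at h1
  refine (Finset.card_lt_card (Finset.ssubset_iff_subset_ne.2 ⟨fun z hz => ?_, fun heq => ?_⟩)).ne
    h1.symm
  · simp only [Finset.mem_filter, Finset.mem_univ, true_and] at hz ⊢
    exact ⟨by omega, hz.2⟩
  · have := Finset.ext_iff.1 heq x
    simp [← hk, ← hj] at this

/-- A transversal permutation is a product of a row and a column permutation. -/
theorem exists_eq_mul_of_transversal {lam : d.Partition} {σ : Equiv.Perm (Fin d)}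
    (h : Transversal lam lam σ) :
    ∃ p ∈ youngPerms (fun i => (tableau lam i).1) d,
      ∃ q ∈ youngPerms (fun i => (tableau lam i).2) d, σ = p * q := by
  choose v hv using exists_tableau_eq_of_transversal h
  have hinj : Function.Injective v := by
    intro x y hxy
    have h1 := (hv x).symm.trans ((congrArg _ hxy).trans (hv y))
    rw [Prod.mk.injEq] at h1
    exact h x y h1.1 h1.2
  -- Within its column, `q` moves each symbol to the row that `σ` assigns to it; what remains of `σ`
  -- preserves rows.
  let q : Equiv.Perm (Fin d) := Equiv.ofBijective v (Finite.injective_iff_bijective.1 hinj)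
  have hq : ∀ x, tableau lam (q x) = ((tableau lam (σ x)).1, (tableau lam x).2) := hv
  refine ⟨σ * q⁻¹, ?_, q, ?_, by simp⟩
  · simp only [youngPerms_top, Finset.mem_filter, Finset.mem_univ, true_and]
    intro x
    simpa using (congrArg Prod.fst (hq (q⁻¹ x))).symm
  · simp only [youngPerms_top, Finset.mem_filter, Finset.mem_univ, true_and]
    intro x
    rw [hq]

theorem rowLen_diagram (lam : d.Partition) (k : ℕ) :
    (diagram lam).rowLen k = rowCount lam (k + 1) - rowCount lam k := by
  have h1 : rowCount lam (k + 1) = rowCount lam k +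
      (Finset.univ.filter fun x => (tableau lam x).1 = k).card := by
    rw [rowCount, rowCount, ← Finset.card_union_of_disjoint]
    · congr 1
      ext x
      simp only [Finset.mem_filter, Finset.mem_univ, true_and, Finset.mem_union]
      omega
    · rw [Finset.disjoint_filter]
      intro x _ h
      omega
  rw [h1, Nat.add_sub_cancel_left, YoungDiagram.rowLen_eq_card]
  symm
  refine Finset.card_bij (fun x _ => tableau lam x) ?_ ?_ ?_
  · intro x hx
    simp only [Finset.mem_filter, Finset.mem_univ, true_and] at hx
    exact YoungDiagram.mem_row_iff.2 ⟨tableau_mem lam x, hx⟩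
  · exact fun x _ y _ hxy => tableau_injective lam hxy
  · intro c hc
    obtain ⟨hc, hck⟩ := YoungDiagram.mem_row_iff.1 hc
    obtain ⟨x, rfl⟩ := exists_tableau_eq lam hc
    exact ⟨x, by simpa using hck, rfl⟩

theorem diagram_injective : Function.Injective (diagram (d := d)) := by
  intro lam mu h
  have hl : ∀ nu : d.Partition, (diagram nu).rowLens = nu.parts.sort (· ≥ ·) := fun nu =>
    YoungDiagram.rowLens_ofRowLens_eq_self fun x hx =>
      nu.parts_pos ((Multiset.mem_sort _).1 hx)
  have h1 : lam.parts.sort (· ≥ ·) = mu.parts.sort (· ≥ ·) := by rw [← hl, ← hl, h]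
  refine Nat.Partition.ext ?_
  rw [← Multiset.sort_eq lam.parts (· ≥ ·), h1, Multiset.sort_eq]

theorem eq_of_rowCount_eq {lam mu : d.Partition} (h : ∀ k, rowCount lam k = rowCount mu k) :
    lam = mu := by
  refine diagram_injective (YoungDiagram.ext (Finset.ext fun ⟨i, j⟩ => ?_))
  rw [YoungDiagram.mem_cells, YoungDiagram.mem_cells, YoungDiagram.mem_iff_lt_rowLen,
    YoungDiagram.mem_iff_lt_rowLen, rowLen_diagram, rowLen_diagram, h, h]

/-! ### Products of Young symmetrizers -/

theorem rowSum_mul_single_mul_colSum_of_not_transversal {lam mu : d.Partition}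
    {σ : Equiv.Perm (Fin d)} (h : ¬ Transversal lam mu σ) :
    rowSum lam d * single σ 1 * colSum mu d = 0 := by
  unfold Transversal at h
  push Not at h
  obtain ⟨x, y, hr, hc, hxy⟩ := h
  exact rowSum_mul_single_mul_colSum_eq_zero _ _ d hxy x.2 y.2 (σ x).2 (σ y).2 hr hc

theorem colSum_mul_single_mul_rowSum_of_not_transversal {lam mu : d.Partition}
    {σ : Equiv.Perm (Fin d)} (h : ¬ Transversal mu lam σ⁻¹) :
    colSum lam d * single σ 1 * rowSum mu d = 0 := by
  unfold Transversal at h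
  push Not at h
  obtain ⟨x, y, hr, hc, hxy⟩ := h
  have h1 : Equiv.swap (σ⁻¹ x) (σ⁻¹ y) ∈ youngPerms (fun i => (tableau mu i).1) d :=
    swap_mem_youngPerms (σ⁻¹ x).2 (σ⁻¹ y).2 hr
  have h2 : Equiv.swap x y ∈ youngPerms (fun i => (tableau lam i).2) d :=
    swap_mem_youngPerms x.2 y.2 hc
  have h3 : single (Equiv.swap (σ⁻¹ x) (σ⁻¹ y)) 1 * rowSum mu d = rowSum mu d :=
    single_mul_youngSum 1 (by simp) h1
  have h4 : colSum lam d * single (Equiv.swap x y) (-1) = colSum lam d := by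
    have := youngSum_mul_single csign csign_mul h2
    rwa [csign_swap hxy] at this
  have h5 : single σ (1 : ℂ) * single (Equiv.swap (σ⁻¹ x) (σ⁻¹ y)) 1 =
      -(single (Equiv.swap x y) (-1) * single σ 1) := by
    rw [single_mul_single, single_mul_single, Equiv.mul_swap_eq_swap_mul]
    simp [← single_neg]
  have h6 : colSum lam d * single σ 1 * rowSum mu d =
      -(colSum lam d * single σ 1 * rowSum mu d) := by
    conv_lhs => rw [← h3, ← mul_assoc, mul_assoc (colSum lam d), h5, mul_neg, ← mul_assoc, h4,
      neg_mul]
  have h7 : (2 : ℂ) • (colSum lam d * single σ 1 * rowSum mu d) = 0 := by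
    rw [two_smul]
    nth_rewrite 1 [h6]
    exact neg_add_cancel _
  exact (smul_eq_zero.1 h7).resolve_left two_ne_zero

theorem mul_mul_eq_zero_of_single {u v : MonoidAlgebra ℂ (Equiv.Perm (Fin d))}
    (h : ∀ σ, u * single σ 1 * v = 0) (x : MonoidAlgebra ℂ (Equiv.Perm (Fin d))) :
    u * x * v = 0 := by
  induction x using MonoidAlgebra.induction_linear with
  | zero => simp
  | add x y hx hy => rw [mul_add, add_mul, hx, hy, add_zero]
  | single τ a =>
    have : single τ a = a • single τ (1 : ℂ) := by simp
    rw [this, mul_smul_comm, smul_mul_assoc, h, smul_zero]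

/-- Transversals in both directions would force dominance both ways, hence equal shapes. So either
the outer pair (rows of `lam`, columns of `mu`) or the inner pair (columns of `lam`, rows of `mu`)
annihilates everything between. -/
theorem youngSymmetrizer_mul_mul_of_ne {lam mu : d.Partition} (h : lam ≠ mu)
    (x : MonoidAlgebra ℂ (Equiv.Perm (Fin d))) :
    youngSymmetrizer lam * x * youngSymmetrizer mu = 0 := by
  rw [youngSymmetrizer_eq, youngSymmetrizer_eq]
  by_cases h1 : ∃ σ, Transversal lam mu σ
  · have h2 : ∀ σ, ¬ Transversal mu lam σ := by
      intro τ hτ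
      obtain ⟨σ, hσ⟩ := h1
      exact h (eq_of_rowCount_eq fun k =>
        (rowCount_le_of_transversal hσ k).antisymm (rowCount_le_of_transversal hτ k))
    have h3 := mul_mul_eq_zero_of_single
      (fun σ => colSum_mul_single_mul_rowSum_of_not_transversal (h2 σ⁻¹)) x
    calc _ = rowSum lam d * (colSum lam d * x * rowSum mu d) * colSum mu d := by
          simp only [mul_assoc]
      _ = 0 := by rw [h3]; simp
  · push Not at h1
    have h3 := mul_mul_eq_zero_of_single
      (fun σ => rowSum_mul_single_mul_colSum_of_not_transversal (h1 σ))
      (colSum lam d * x * rowSum mu d)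
    simpa only [mul_assoc] using h3

/-- A permutation preserving rows and columns fixes every cell, so `p * q = 1` only for `p = q = 1`.
-/
theorem coeff_youngSymmetrizer_one (lam : d.Partition) :
    (youngSymmetrizer lam).coeff 1 = 1 := by
  rw [youngSymmetrizer_eq, rowSum, colSum, youngSum, youngSum, Finset.sum_mul_sum, coeff_sum,
    Finsupp.finsetSum_apply]
  have hone : ∀ t : Fin d → ℕ, (1 : Equiv.Perm (Fin d)) ∈ youngPerms t d := fun t => by
    simp [mem_youngPerms]
  have hpq : ∀ p ∈ youngPerms (fun i => (tableau lam i).1) d,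
      ∀ q ∈ youngPerms (fun i => (tableau lam i).2) d, p * q = 1 → p = 1 ∧ q = 1 := by
    intro p hp q hq h
    have hpq' : p = q⁻¹ := mul_eq_one_iff_eq_inv.1 h
    have hp1 : p = 1 := by
      ext x
      have hx : p x = x := by
        refine tableau_injective lam (Prod.ext ((mem_youngPerms.1 hp).1 x) ?_)
        rw [hpq']
        exact (mem_youngPerms.1 (inv_mem_youngPerms hq)).1 x
      rw [hx]
      rfl
    exact ⟨hp1, by rw [hp1, one_mul] at h; exact h⟩
  rw [Finset.sum_eq_single_of_mem 1 (hone _)]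
  · rw [coeff_sum, Finsupp.finsetSum_apply, Finset.sum_eq_single_of_mem 1 (hone _)]
    · simp [csign, single_mul_single]
    · intro q hq hq1
      rw [single_mul_single, coeff_single, Finsupp.single_apply, if_neg]
      simpa using hq1
  · intro p hp hp1
    rw [coeff_sum, Finsupp.finsetSum_apply]
    refine Finset.sum_eq_zero fun q hq => ?_
    rw [single_mul_single, coeff_single, Finsupp.single_apply, if_neg]
    exact fun h => hp1 (hpq p hp q hq h).1

/-- A permutation between the two sums gives zero unless it is transversal; then it factors as `p *
q`, and both factors are absorbed up to the sign of `q`. The scalar is read off at the identity,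
where `c_λ` has coefficient `1`. -/
theorem rowSum_mul_mul_colSum (lam : d.Partition) (x : MonoidAlgebra ℂ (Equiv.Perm (Fin d))) :
    rowSum lam d * x * colSum lam d =
      (rowSum lam d * x * colSum lam d).coeff 1 • youngSymmetrizer lam := by
  have hc : ∀ s : ℂ, (s • youngSymmetrizer lam).coeff 1 = s := by
    intro s
    simp [coeff_youngSymmetrizer_one]
  induction x using MonoidAlgebra.induction_linear with
  | zero => simp
  | add x y hx hy =>
    rw [mul_add, add_mul, coeff_add, Finsupp.add_apply, add_smul, ← hx, ← hy]
  | single τ a =>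
    obtain ⟨s, hs⟩ : ∃ s : ℂ, rowSum lam d * single τ a * colSum lam d =
        s • youngSymmetrizer lam := by
      have hτ : single τ a = a • single τ (1 : ℂ) := by simp
      rw [hτ, mul_smul_comm, smul_mul_assoc]
      by_cases h : Transversal lam lam τ
      · obtain ⟨p, hp, q, hq, rfl⟩ := exists_eq_mul_of_transversal h
        refine ⟨a * csign q, ?_⟩
        have h1 : single (p * q) (1 : ℂ) = single p 1 * single q 1 := by
          rw [single_mul_single, one_mul]
        rw [h1, ← mul_assoc, symmetrizer_mul_single hp, mul_assoc,
          single_mul_antisymmetrizer hq, mul_smul_comm, smul_smul, youngSymmetrizer_eq]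
      · exact ⟨0, by rw [rowSum_mul_single_mul_colSum_of_not_transversal h, smul_zero, zero_smul]⟩
    rw [hs, hc]

/-! ### Conjugacy classes -/

theorem cycleTypePartition_eq_iff {π τ : Equiv.Perm (Fin d)} :
    cycleTypePartition π = cycleTypePartition τ ↔ IsConj π τ := by
  rw [Equiv.Perm.partition_eq_of_isConj, Nat.Partition.ext_iff, Nat.Partition.ext_iff]
  rfl

theorem numCycles_inv (π : Equiv.Perm (Fin d)) : numCycles π⁻¹ = numCycles π := by
  have h : IsConj π⁻¹ π := Equiv.Perm.isConj_iff_cycleType_eq.2 (Equiv.Perm.cycleType_inv π)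
  rw [numCycles, cycleTypePartition_eq_iff.2 h, numCycles]

theorem cycleTypePartition_surjective :
    Function.Surjective (cycleTypePartition : Equiv.Perm (Fin d) → d.Partition) := by
  intro lam
  -- The parts of size at least `2` are realized as a cycle type; the remaining parts are ones, the
  -- fixed points.
  have hsplit : lam.parts.filter (2 ≤ ·) +
      Multiset.replicate (d - (lam.parts.filter (2 ≤ ·)).sum) 1 = lam.parts := by
    have h1 : lam.parts.filter (fun n => ¬ 2 ≤ n) =
        Multiset.replicate (lam.parts.filter fun n => ¬ 2 ≤ n).card 1 := by
      refine Multiset.eq_replicate_card.2 fun n hn => ?_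
      rw [Multiset.mem_filter] at hn
      have := lam.parts_pos hn.1
      omega
    have h2 := Multiset.filter_add_not (fun n => 2 ≤ n) lam.parts
    have h3 : (lam.parts.filter (2 ≤ ·)).sum + (lam.parts.filter fun n => ¬ 2 ≤ n).card = d := by
      have h4 := congrArg Multiset.sum h2
      rw [Multiset.sum_add, lam.parts_sum, h1, Multiset.sum_replicate] at h4
      simpa using h4
    have h5 : d - (lam.parts.filter (2 ≤ ·)).sum =
        (lam.parts.filter fun n => ¬ 2 ≤ n).card := by omega
    rw [h5, ← h1, h2]
  obtain ⟨π, hπ⟩ := (Equiv.Perm.exists_with_cycleType_iff (Fin d)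
    (m := lam.parts.filter (2 ≤ ·))).2 ⟨by
      rw [Fintype.card_fin]
      have h := congrArg Multiset.sum (Multiset.filter_add_not (fun n => 2 ≤ n) lam.parts)
      rw [Multiset.sum_add, lam.parts_sum] at h
      omega, fun n hn => (Multiset.mem_filter.1 hn).2⟩
  refine ⟨π, Nat.Partition.ext ?_⟩
  change π.partition.parts = lam.parts
  rw [Equiv.Perm.parts_partition, ← Equiv.Perm.sum_cycleType, hπ, Fintype.card_fin, hsplit]

/-! ### Characters and dimensions of the irreducible modules -/

/-- The scalar `n` with `c_λ ^ 2 = n c_λ`. -/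
def hookNumber (lam : d.Partition) : ℂ :=
  (youngSymmetrizer lam * youngSymmetrizer lam).coeff 1

theorem youngSymmetrizer_mul_mul (lam : d.Partition)
    (x : MonoidAlgebra ℂ (Equiv.Perm (Fin d))) :
    youngSymmetrizer lam * x * youngSymmetrizer lam =
      (youngSymmetrizer lam * x * youngSymmetrizer lam).coeff 1 • youngSymmetrizer lam := by
  have h := rowSum_mul_mul_colSum lam (colSum lam d * x * rowSum lam d)
  have h1 : rowSum lam d * (colSum lam d * x * rowSum lam d) * colSum lam d =
      youngSymmetrizer lam * x * youngSymmetrizer lam := by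
    rw [youngSymmetrizer_eq]
    simp only [mul_assoc]
  rw [h1] at h
  exact h

theorem youngSymmetrizer_mul_self (lam : d.Partition) :
    youngSymmetrizer lam * youngSymmetrizer lam = hookNumber lam • youngSymmetrizer lam := by
  have h := youngSymmetrizer_mul_mul lam 1
  rwa [mul_one] at h

theorem mul_youngSymmetrizer_of_central (lam : d.Partition)
    {z : MonoidAlgebra ℂ (Equiv.Perm (Fin d))} (hz : ∀ x, Commute z x) :
    z * youngSymmetrizer lam = (z * youngSymmetrizer lam).coeff 1 • youngSymmetrizer lam := by
  have h := rowSum_mul_mul_colSum lam z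
  rwa [← (hz _).eq, mul_assoc, ← youngSymmetrizer_eq] at h

instance finite_groupAlgebra : Module.Finite ℂ (MonoidAlgebra ℂ (Equiv.Perm (Fin d))) :=
  Module.Finite.of_basis (MonoidAlgebra.basis (Equiv.Perm (Fin d)) ℂ)

instance finite_irrep (lam : d.Partition) : Module.Finite ℂ (irrep lam) :=
  Module.Finite.of_injective ((irrep lam).subtype.restrictScalars ℂ) Subtype.val_injective

/-- The sum of all conjugates of the Young symmetrizer. -/
def conjSum (lam : d.Partition) : MonoidAlgebra ℂ (Equiv.Perm (Fin d)) :=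
  ∑ π, single π 1 * youngSymmetrizer lam * single π⁻¹ 1

theorem coeff_single_one_mul_apply (u : MonoidAlgebra ℂ (Equiv.Perm (Fin d)))
    (π τ : Equiv.Perm (Fin d)) : (single π 1 * u).coeff τ = u.coeff (π⁻¹ * τ) := by
  have h := coeff_single_mul_mul u 1 π (π⁻¹ * τ)
  rwa [mul_inv_cancel_left, one_mul] at h

theorem coeff_conjSum (lam : d.Partition) (τ : Equiv.Perm (Fin d)) :
    (conjSum lam).coeff τ = ∑ π, (youngSymmetrizer lam).coeff (π⁻¹ * τ * π) := by
  rw [conjSum, coeff_sum, Finsupp.finsetSum_apply]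
  refine Finset.sum_congr rfl fun π _ => ?_
  rw [coeff_mul_single_apply, coeff_single_one_mul_apply, mul_one, inv_inv, mul_assoc]

theorem trace_mulLeft_mulRight (u : MonoidAlgebra ℂ (Equiv.Perm (Fin d)))
    (τ : Equiv.Perm (Fin d)) :
    LinearMap.trace ℂ _ (LinearMap.mulLeft ℂ (single τ (1 : ℂ)) ∘ₗ LinearMap.mulRight ℂ u) =
      ∑ π, u.coeff (π⁻¹ * τ⁻¹ * π) := by
  rw [LinearMap.trace_eq_matrix_trace ℂ (MonoidAlgebra.basis (Equiv.Perm (Fin d)) ℂ)]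
  refine Finset.sum_congr rfl fun π _ => ?_
  rw [Matrix.diag_apply, LinearMap.toMatrix_apply]
  change (single τ 1 * (single π 1 * u)).coeff π = _
  rw [coeff_single_one_mul_apply, coeff_single_one_mul_apply, mul_assoc]

/-- Both sides are the trace of `x ↦ τ x c_λ` on the group algebra. Right multiplication by `c_λ`
factors through `V^λ`, where it is the scalar `n_λ`; in the basis of permutations the trace is a sum
over conjugates. -/
theorem hookNumber_mul_irrepChar (lam : d.Partition) (τ : Equiv.Perm (Fin d)) :
    hookNumber lam * irrepChar lam τ = (conjSum lam).coeff τ⁻¹ := by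
  let ι : irrep lam →ₗ[ℂ] MonoidAlgebra ℂ (Equiv.Perm (Fin d)) :=
    (irrep lam).subtype.restrictScalars ℂ
  let p : MonoidAlgebra ℂ (Equiv.Perm (Fin d)) →ₗ[ℂ] irrep lam :=
    ((LinearMap.toSpanSingleton _ _ (youngSymmetrizer lam)).codRestrict (irrep lam) fun x =>
      Submodule.smul_mem _ x (Submodule.mem_span_singleton_self _)).restrictScalars ℂ
  have hpι : p ∘ₗ ι = hookNumber lam • LinearMap.id := by
    ext ⟨y, hy⟩ : 2
    obtain ⟨x, rfl⟩ := Submodule.mem_span_singleton.1 hy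
    change x * youngSymmetrizer lam * youngSymmetrizer lam =
      hookNumber lam • (x * youngSymmetrizer lam)
    rw [mul_assoc, youngSymmetrizer_mul_self, mul_smul_comm]
  have hcomp : ι ∘ₗ (irrepAction lam τ ∘ₗ p) =
      LinearMap.mulLeft ℂ (single τ (1 : ℂ)) ∘ₗ LinearMap.mulRight ℂ (youngSymmetrizer lam) :=
    LinearMap.ext fun x => rfl
  rw [coeff_conjSum, ← trace_mulLeft_mulRight, ← hcomp, LinearMap.trace_comp_comm',
    LinearMap.comp_assoc, hpι, LinearMap.comp_smul, LinearMap.comp_id, map_smul, smul_eq_mul]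
  rfl

theorem hookNumber_mul_irrepDim (lam : d.Partition) :
    hookNumber lam * (irrepDim lam : ℂ) = (d.factorial : ℂ) := by
  have h := hookNumber_mul_irrepChar lam 1
  have h1 : irrepChar lam 1 = (irrepDim lam : ℂ) := Representation.char_one (irrepAction lam)
  rw [h1, coeff_conjSum] at h
  rw [h]
  simp [coeff_youngSymmetrizer_one, Fintype.card_perm]

theorem hookNumber_ne_zero (lam : d.Partition) : hookNumber lam ≠ 0 := by
  intro h
  have h1 := hookNumber_mul_irrepDim lam
  rw [h, zero_mul] at h1
  exact Nat.cast_ne_zero.2 d.factorial_ne_zero h1.symm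

/-! ### Completeness -/

theorem coeff_conjSum_conj (lam : d.Partition) (ρ τ : Equiv.Perm (Fin d)) :
    (conjSum lam).coeff (ρ * τ * ρ⁻¹) = (conjSum lam).coeff τ := by
  rw [coeff_conjSum, coeff_conjSum]
  refine Finset.sum_bij' (fun π _ => ρ⁻¹ * π) (fun π _ => ρ * π) (by simp) (by simp) (by simp)
    (by simp) (fun π _ => ?_)
  have h : π⁻¹ * (ρ * τ * ρ⁻¹) * π = (ρ⁻¹ * π)⁻¹ * τ * (ρ⁻¹ * π) := by group
  rw [h]

/-- The element of the group algebra whose coefficients are a function of the cycle type. -/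
def classElement (d : ℕ) : (d.Partition → ℂ) →ₗ[ℂ] MonoidAlgebra ℂ (Equiv.Perm (Fin d)) where
  toFun f := ∑ π, single π (f (cycleTypePartition π))
  map_add' f g := by simp [single_add, Finset.sum_add_distrib]
  map_smul' a f := by simp [Finset.smul_sum]

theorem coeff_classElement (f : d.Partition → ℂ) (τ : Equiv.Perm (Fin d)) :
    (classElement d f).coeff τ = f (cycleTypePartition τ) := by
  change (∑ π, single π (f (cycleTypePartition π))).coeff τ = _
  rw [coeff_sum, Finsupp.finsetSum_apply, Finset.sum_eq_single τ]
  · simp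
  · intro π _ h
    simp [h]
  · simp

theorem exists_classElement_eq {x : MonoidAlgebra ℂ (Equiv.Perm (Fin d))}
    (hx : ∀ ρ τ, x.coeff (ρ * τ * ρ⁻¹) = x.coeff τ) : ∃ f, classElement d f = x := by
  choose r hr using cycleTypePartition_surjective (d := d)
  refine ⟨fun lam => x.coeff (r lam), MonoidAlgebra.ext (Finsupp.ext fun τ => ?_)⟩
  rw [coeff_classElement]
  obtain ⟨ρ, hρ⟩ := isConj_iff.1 (cycleTypePartition_eq_iff.1 (hr (cycleTypePartition τ)))
  conv_rhs => rw [← hρ, hx]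

theorem classElement_commute (f : d.Partition → ℂ) (x : MonoidAlgebra ℂ (Equiv.Perm (Fin d))) :
    Commute (classElement d f) x :=
  sum_single_commute (fun π τ => congrArg f
    (cycleTypePartition_eq_iff.2 (isConj_iff.2 ⟨τ, by group⟩))) x

theorem conjSum_commute (lam : d.Partition) (x : MonoidAlgebra ℂ (Equiv.Perm (Fin d))) :
    Commute (conjSum lam) x := by
  obtain ⟨f, hf⟩ := exists_classElement_eq (coeff_conjSum_conj lam)
  rw [← hf]
  exact classElement_commute f x

theorem conjSum_mul_youngSymmetrizer_of_ne {lam mu : d.Partition} (h : lam ≠ mu) :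
    conjSum lam * youngSymmetrizer mu = 0 := by
  rw [conjSum, Finset.sum_mul]
  refine Finset.sum_eq_zero fun π _ => ?_
  rw [mul_assoc, mul_assoc, ← mul_assoc (youngSymmetrizer lam),
    youngSymmetrizer_mul_mul_of_ne h, mul_zero]

theorem sum_coeff_smul_single (x : MonoidAlgebra ℂ (Equiv.Perm (Fin d))) :
    ∑ π, x.coeff π • single π (1 : ℂ) = x := by
  refine MonoidAlgebra.ext (Finsupp.ext fun τ => ?_)
  rw [coeff_sum, Finsupp.finsetSum_apply, Finset.sum_eq_single τ]
  · simp
  · intro π _ h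
    simp [h]
  · simp

/-- By centrality the product is a multiple of `c`, determined by its coefficient at the identity.
If `c π⁻¹ c = s c`, then `π c π⁻¹ c` and `c (c(π⁻¹) π⁻¹) c` both have coefficient `s c(π⁻¹)` there.
Summing over `π` gives the coefficient of `c³`, which is `n_λ²`. -/
theorem conjSum_mul_youngSymmetrizer (lam : d.Partition) :
    conjSum lam * youngSymmetrizer lam = hookNumber lam ^ 2 • youngSymmetrizer lam := by
  set c := youngSymmetrizer lam with hc
  have h1 : (conjSum lam * c).coeff 1 = (c * c * c).coeff 1 := by
    have h2 : ∀ π : Equiv.Perm (Fin d), (single π 1 * c * single π⁻¹ 1 * c).coeff 1 =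
        (c * (c.coeff π⁻¹ • single π⁻¹ 1) * c).coeff 1 := by
      intro π
      have h3 : c * single π⁻¹ 1 * c = (c * single π⁻¹ 1 * c).coeff 1 • c :=
        youngSymmetrizer_mul_mul lam _
      have h4 : single π 1 * c * single π⁻¹ 1 * c = single π 1 * (c * single π⁻¹ 1 * c) := by
        simp only [mul_assoc]
      rw [h4, coeff_single_one_mul_apply, mul_one, mul_smul_comm, smul_mul_assoc, h3, coeff_smul,
        coeff_smul, coeff_smul, Finsupp.smul_apply, Finsupp.smul_apply, Finsupp.smul_apply,
        coeff_youngSymmetrizer_one, smul_eq_mul, smul_eq_mul, smul_eq_mul, mul_one, mul_comm]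
    calc (conjSum lam * c).coeff 1
        = ∑ π : Equiv.Perm (Fin d), (c * (c.coeff π⁻¹ • single π⁻¹ 1) * c).coeff 1 := by
          rw [conjSum, Finset.sum_mul, coeff_sum, Finsupp.finsetSum_apply]
          exact Finset.sum_congr rfl fun π _ => h2 π
      _ = ∑ π : Equiv.Perm (Fin d), (c * (c.coeff π • single π 1) * c).coeff 1 :=
          Equiv.sum_comp (Equiv.inv (Equiv.Perm (Fin d)))
            fun π => (c * (c.coeff π • single π 1) * c).coeff 1
      _ = (c * c * c).coeff 1 := by
          rw [← Finsupp.finsetSum_apply, ← coeff_sum, ← Finset.sum_mul, ← Finset.mul_sum,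
            sum_coeff_smul_single]
  rw [mul_youngSymmetrizer_of_central lam (conjSum_commute lam), ← hc, h1,
    youngSymmetrizer_mul_self, smul_mul_assoc, youngSymmetrizer_mul_self, smul_smul, coeff_smul,
    Finsupp.smul_apply, coeff_youngSymmetrizer_one, smul_eq_mul, mul_one, sq]

/-- A class function is determined by the scalars by which it acts on the Young symmetrizers. -/
theorem classElement_eq_zero {f : d.Partition → ℂ}
    (hf : ∀ lam, classElement d f * youngSymmetrizer lam = 0) : f = 0 := by
  let Ψ : (d.Partition → ℂ) →ₗ[ℂ] (d.Partition → ℂ) :=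
    { toFun := fun f lam => (classElement d f * youngSymmetrizer lam).coeff 1
      map_add' := fun f g => by
        funext lam
        simp [add_mul]
      map_smul' := fun a f => by
        funext lam
        simp }
  -- `Ψ` is an endomorphism of a finite-dimensional space, so surjectivity suffices; the `z_λ` are
  -- sent to nonzero multiples of the coordinate vectors.
  have hsurj : Function.Surjective Ψ := by
    intro g
    choose z hz using fun lam : d.Partition => exists_classElement_eq (coeff_conjSum_conj lam)
    have hΨ : ∀ lam mu, Ψ (z lam) mu = if lam = mu then hookNumber lam ^ 2 else 0 := by
      intro lam mu
      change (classElement d (z lam) * youngSymmetrizer mu).coeff 1 = _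
      rw [hz]
      split_ifs with h
      · subst h
        rw [conjSum_mul_youngSymmetrizer, coeff_smul, Finsupp.smul_apply,
          coeff_youngSymmetrizer_one, smul_eq_mul, mul_one]
      · rw [conjSum_mul_youngSymmetrizer_of_ne h]
        simp
    refine ⟨∑ lam, (g lam / hookNumber lam ^ 2) • z lam, funext fun mu => ?_⟩
    simp only [map_sum, map_smul, Finset.sum_apply, Pi.smul_apply, hΨ, smul_eq_mul, mul_ite,
      mul_zero, Finset.sum_ite_eq', Finset.mem_univ, if_true]
    rw [div_mul_cancel₀ _ (pow_ne_zero 2 (hookNumber_ne_zero mu))]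
  refine LinearMap.injective_iff_surjective.2 hsurj ?_
  rw [map_zero]
  funext lam
  change (classElement d f * youngSymmetrizer lam).coeff 1 = 0
  rw [hf]
  simp

/-- The difference of the two sides is a class function that annihilates every Young symmetrizer. -/
theorem sum_conjSum : ∑ lam : d.Partition, (hookNumber lam ^ 2)⁻¹ • conjSum lam = 1 := by
  have hinv : ∀ ρ τ : Equiv.Perm (Fin d),
      (∑ lam : d.Partition, (hookNumber lam ^ 2)⁻¹ • conjSum lam - 1).coeff (ρ * τ * ρ⁻¹) =
      (∑ lam : d.Partition, (hookNumber lam ^ 2)⁻¹ • conjSum lam - 1).coeff τ := by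
    intro ρ τ
    have h1 : (1 : MonoidAlgebra ℂ (Equiv.Perm (Fin d))).coeff (ρ * τ * ρ⁻¹) =
        (1 : MonoidAlgebra ℂ (Equiv.Perm (Fin d))).coeff τ := by
      classical
      rw [one_def, coeff_single, Finsupp.single_apply, Finsupp.single_apply]
      congr 1
      simp only [eq_comm (a := (1 : Equiv.Perm (Fin d))), conj_eq_one_iff]
    simp only [coeff_sub, Finsupp.sub_apply, coeff_sum, Finsupp.finsetSum_apply, coeff_smul,
      Finsupp.smul_apply, coeff_conjSum_conj, h1]
  obtain ⟨f, hf⟩ := exists_classElement_eq hinv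
  have h0 : f = 0 := by
    refine classElement_eq_zero fun mu => ?_
    rw [hf, sub_mul, one_mul, Finset.sum_mul, Finset.sum_eq_single mu]
    · rw [smul_mul_assoc, conjSum_mul_youngSymmetrizer, smul_smul,
        inv_mul_cancel₀ (pow_ne_zero 2 (hookNumber_ne_zero mu)), one_smul, sub_self]
    · intro lam _ h
      rw [smul_mul_assoc, conjSum_mul_youngSymmetrizer_of_ne h, smul_zero]
    · simp
  rw [h0, map_zero] at hf
  exact (sub_eq_zero.1 hf.symm)

/-! ### The Weingarten element -/

/-- The product of the factors `N + content` over the cells of a diagram. -/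
abbrev contentProd (N : ℕ) (lam : d.Partition) : ℂ :=
  ∏ c ∈ (diagram lam).cells, ((N : ℂ) + (content c : ℂ))

/-- The inverse of the Gram element. -/
def weingartenElement (d N : ℕ) : MonoidAlgebra ℂ (Equiv.Perm (Fin d)) :=
  ∑ lam : d.Partition, (contentProd N lam * hookNumber lam ^ 2)⁻¹ • conjSum lam

theorem gramElement_mul_conjSum {N : ℕ} (hd : d ≤ N) (lam : d.Partition) :
    gramElement d N * conjSum lam = contentProd N lam • conjSum lam := by
  rw [conjSum, Finset.mul_sum, Finset.smul_sum]
  refine Finset.sum_congr rfl fun π _ => ?_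
  rw [← mul_assoc, ← mul_assoc, (gramElement_commute d N _).eq, mul_assoc (single π 1),
    gramElement_mul_youngSymmetrizer hd, mul_smul_comm, smul_mul_assoc]

theorem weingartenElement_mul_gramElement {N : ℕ} (hd : d ≤ N) :
    weingartenElement d N * gramElement d N = 1 := by
  rw [← (gramElement_commute d N _).eq, weingartenElement, Finset.mul_sum, ← sum_conjSum]
  refine Finset.sum_congr rfl fun lam _ => ?_
  rw [mul_smul_comm, gramElement_mul_conjSum hd, smul_smul, mul_inv, mul_right_comm,
    inv_mul_cancel₀ (prod_content_ne_zero hd lam), one_mul]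

theorem coeff_weingartenElement_conj (N : ℕ) (ρ τ : Equiv.Perm (Fin d)) :
    (weingartenElement d N).coeff (ρ * τ * ρ⁻¹) = (weingartenElement d N).coeff τ := by
  simp only [weingartenElement, coeff_sum, Finsupp.finsetSum_apply, coeff_smul,
    Finsupp.smul_apply, coeff_conjSum_conj]

theorem coeff_weingartenElement_inv (N : ℕ) (τ : Equiv.Perm (Fin d)) :
    (weingartenElement d N).coeff τ⁻¹ = ∑ lam : d.Partition,
      irrepChar lam τ / contentProd N lam * ((irrepDim lam : ℂ) / (d.factorial : ℂ)) := by
  rw [weingartenElement, coeff_sum, Finsupp.finsetSum_apply]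
  refine Finset.sum_congr rfl fun lam _ => ?_
  have hn := hookNumber_ne_zero lam
  have hf : (d.factorial : ℂ) ≠ 0 := Nat.cast_ne_zero.2 d.factorial_ne_zero
  have hdim : (irrepDim lam : ℂ) / (d.factorial : ℂ) = (hookNumber lam)⁻¹ := by
    rw [div_eq_iff hf, ← hookNumber_mul_irrepDim lam, inv_mul_cancel_left₀ hn]
  rw [hdim, coeff_smul, Finsupp.smul_apply, ← hookNumber_mul_irrepChar, smul_eq_mul, mul_inv,
    div_eq_mul_inv]
  field_simp

theorem coeff_mul_eq_sum (x y : MonoidAlgebra ℂ (Equiv.Perm (Fin d))) (τ : Equiv.Perm (Fin d)) :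
    (x * y).coeff τ = ∑ π, x.coeff π * y.coeff (π⁻¹ * τ) := by
  conv_lhs => rw [← sum_coeff_smul_single x]
  rw [Finset.sum_mul, coeff_sum, Finsupp.finsetSum_apply]
  refine Finset.sum_congr rfl fun π _ => ?_
  rw [smul_mul_assoc, coeff_smul, Finsupp.smul_apply, coeff_single_one_mul_apply, smul_eq_mul]

theorem coeff_gramElement (N : ℕ) (τ : Equiv.Perm (Fin d)) :
    (gramElement d N).coeff τ = (N : ℂ) ^ numCycles τ := by
  rw [gramElement, coeff_sum, Finsupp.finsetSum_apply, Finset.sum_eq_single τ]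
  · simp
  · intro π _ h
    simp [h]
  · simp

/-! ### Inverting the Gram matrix by the Weingarten element -/

section

variable {H : Type*} [NormedAddCommGroup H] [InnerProductSpace ℂ H] {N : ℕ}

theorem gramMatrix_mul_weingartenElement (e : OrthonormalBasis (Fin N) ℂ H) (hd : d ≤ N) :
    gramMatrix e d * Matrix.of (fun ρ σ => (weingartenElement d N).coeff (ρ⁻¹ * σ)⁻¹) = 1 := by
  classical
  ext ρ σ
  have h : ((weingartenElement d N * gramElement d N).coeff (σ⁻¹ * ρ)) =
      (1 : Matrix (Equiv.Perm (Fin d)) (Equiv.Perm (Fin d)) ℂ) ρ σ := by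
    rw [weingartenElement_mul_gramElement hd, one_def, coeff_single, Finsupp.single_apply,
      Matrix.one_apply]
    congr 1
    rw [eq_comm (a := (1 : Equiv.Perm (Fin d))), inv_mul_eq_one, eq_comm (a := σ)]
  rw [← h, Matrix.mul_apply, coeff_mul_eq_sum]
  -- With `π = σ⁻¹τ`, the convolution at `σ⁻¹ρ` has Gram factor `τ⁻¹ρ`, the inverse of `ρ⁻¹τ`, which
  -- has the same number of cycles.
  refine Fintype.sum_equiv (Equiv.mulLeft σ⁻¹) _ _ fun τ => ?_
  rw [Matrix.of_apply, gramMatrix_apply, coeff_gramElement, mul_comm, ← numCycles_inv]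
  simp [mul_assoc]

theorem weingartenMatrix_apply (e : OrthonormalBasis (Fin N) ℂ H) (hd : d ≤ N)
    (ρ σ : Equiv.Perm (Fin d)) :
    weingartenMatrix e d ρ σ = (weingartenElement d N).coeff (ρ⁻¹ * σ)⁻¹ := by
  rw [weingartenMatrix, Matrix.inv_eq_right_inv (gramMatrix_mul_weingartenElement e hd),
    Matrix.of_apply]

theorem gramMatrix_mul_weingartenMatrix (e : OrthonormalBasis (Fin N) ℂ H) (hd : d ≤ N) :
    gramMatrix e d * weingartenMatrix e d = 1 := by
  have h := gramMatrix_mul_weingartenElement e hd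
  rwa [← Matrix.inv_eq_right_inv h] at h

end

end Weingarten

end

theorem theorem4p3 {H : Type*} [NormedAddCommGroup H] [InnerProductSpace ℂ H] {N d : ℕ}
    (e : OrthonormalBasis (Fin N) ℂ H) (hd : d ≤ N) :
    Weingarten.gramMatrix e d =
        Matrix.of (fun ρ σ : Equiv.Perm (Fin d) => (N : ℂ) ^ Weingarten.numCycles (ρ⁻¹ * σ)) ∧
    Weingarten.weingartenMatrix e d * Weingarten.gramMatrix e d = 1 ∧
    Weingarten.gramMatrix e d * Weingarten.weingartenMatrix e d = 1 ∧
    (∀ ρ σ : Equiv.Perm (Fin d),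
      Weingarten.weingartenMatrix e d ρ σ =
        ∑ lam : d.Partition,
          Weingarten.irrepChar lam (ρ⁻¹ * σ) /
              (∏ c ∈ (Weingarten.diagram lam).cells, ((N : ℂ) + (Weingarten.content c : ℂ))) *
            ((Weingarten.irrepDim lam : ℂ) / (d.factorial : ℂ))) ∧
    ∃! Wg : d.Partition → ℂ, ∀ ρ σ : Equiv.Perm (Fin d),
      Weingarten.weingartenMatrix e d ρ σ = Wg (Weingarten.cycleTypePartition (ρ⁻¹ * σ)) := by
  have hright := Weingarten.gramMatrix_mul_weingartenMatrix e hd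
  refine ⟨Matrix.ext fun ρ σ => Weingarten.gramMatrix_apply e ρ σ,
    mul_eq_one_comm.1 hright, hright, fun ρ σ => ?_, ?_⟩
  · rw [Weingarten.weingartenMatrix_apply e hd, Weingarten.coeff_weingartenElement_inv]
  · choose r hr using Weingarten.cycleTypePartition_surjective (d := d)
    refine ⟨fun lam => (Weingarten.weingartenElement d N).coeff (r lam)⁻¹, fun ρ σ => ?_,
      fun Wg hWg => funext fun lam => ?_⟩
    · obtain ⟨τ, hτ⟩ := isConj_iff.1 (Weingarten.cycleTypePartition_eq_iff.1
        (hr (Weingarten.cycleTypePartition (ρ⁻¹ * σ))))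
      rw [Weingarten.weingartenMatrix_apply e hd, ← hτ, conj_inv,
        Weingarten.coeff_weingartenElement_conj, hτ]
    · have h := hWg 1 (r lam)
      rw [inv_one, one_mul, hr, Weingarten.weingartenMatrix_apply e hd, inv_one, one_mul] at h
      exact h.symm
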